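/- Let $n\ge 3$, let $X_1,\dots,X_n$ be independent random variables, each uniformly distributed on $[0,1]$, let $\overline X=\frac1n\sum_{i=1}^n X_i$ and $Q=\sum_{i=1}^n (X_i-\overline X)^2$. Put $$Q_{\max}=\begin{cases} n/4, & n \text{ even},\\ (n^2-1)/(4n), & n\text{ odd},\end{cases}\qquad t_k=\frac{k\pi}{Q_{\max}}=\begin{cases} 4k\pi/n, & n \text{ even},\\ 4k\pi n/(n^2-1), & n\text{ odd}\end{cases}\quad(k\ge1),$$ let $\operatorname{erf}(z)=\frac{2}{\sqrt\pi}\int_0^z e^{-w^2}\,dw$ be the complex error function, take principal values of all powers and square roots, and set $$A_k(y)=\Im\Big((i/t_k)^{n/2}\big(\operatorname{erf}(y+\sqrt{-it_k})-\operatorname{erf}(y)\big)^n\Big),$$ $$B_k(u)=\Im\Big((i/t_k)^{(n-1)/2}\big(\operatorname{erf}(\tfrac12\sqrt{-it_k}\,(u+1))-\operatorname{erf}(\tfrac12\sqrt{-it_k}\,(u-1))\big)^n\Big).$$ Then for $0\le x<Q_{\max}$ the cumulative distribution function of $Q$ is $$F(x)=\Pr\{Q\le x\}=\tfrac12\sqrt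 n\,\Big(\frac{\sqrt\pi}{2}\Big)^{n-3}\bigg(\int_0^\infty\sum_{k=1}^\infty A_k(y)\,\frac{1-\cos(t_kx)}{k}\,dy+\frac12\int_0^1\sum_{k=1}^\infty B_k(u)\,\frac{1-\cos(t_kx)}{k}\,du\bigg),$$ where both series converge absolutely for all $y\ge0$ and $u\in[0,1]$, and both integrands are (absolutely) integrable. If $n\ge4$, the density of $Q$ is obtained by differentiating under the integrals: for $0\le x<Q_{\max}$ both integrands are differentiable in $x$, with derivatives given by the absolutely convergent, termwise differentiated series, these derivatives are integrable, and $F$ is differentiable at $x$ with $$F'(x)=f(x)=\tfrac12\sqrt n\,\Big(\frac{\sqrt\pi}{2}\Big)^{n-3}\bigg(\int_0^\infty\sum_{k=1}^\infty A_k(y)\,\frac{t_k\sin(t_kx)}{k}\,dy+\frac12\int_0^1\sum_{k=1}^\infty B_k(u)\,\frac{t_k\sin(t_kx)}{k}\,du\bigg);$$ the law of $Q$ has the density $f$ on $[0,Q_{\max})$ and $0$ elsewhere. -/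

import Mathlib

open MeasureTheory ProbabilityTheory

namespace UniformSampleVariance

noncomputable section

/-- The complex error function `erf z = (2/√π) ∫_0^z exp(-w²) dw`, the integral being taken along
the segment `w = s z`, `0 ≤ s ≤ 1` (the integrand is entire, so the path does not matter). -/
def erf (z : ℂ) : ℂ :=
  (2 / (Real.sqrt Real.pi : ℂ)) * (z * ∫ s in (0 : ℝ)..1, Complex.exp (-(z * (s : ℂ)) ^ 2))

/-- `Q(v) = ∑ (v_i - v̄)²`, with `v̄` the arithmetic mean of `v_1, …, v_n`. -/
def Q {n : ℕ} (v : Fin n → ℝ) : ℝ :=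
  ∑ i, (v i - (∑ j, v j) / (n : ℝ)) ^ 2

/-- `n/4` for even `n` and `(n² - 1)/(4n)` for odd `n`. -/
def Qmax (n : ℕ) : ℝ :=
  if Even n then (n : ℝ) / 4 else ((n : ℝ) ^ 2 - 1) / (4 * (n : ℝ))

/-- The frequencies `t_k`: `4kπ/n` for even `n` and `4kπn/(n² - 1)` for odd `n`. -/
def freq (n k : ℕ) : ℝ :=
  if Even n then 4 * (k : ℝ) * Real.pi / (n : ℝ)
  else 4 * (k : ℝ) * Real.pi * (n : ℝ) / ((n : ℝ) ^ 2 - 1)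

/-- The principal square root `√(-it)`. -/
def sqrtNegI (t : ℝ) : ℂ := (-(Complex.I * (t : ℂ))) ^ (1 / 2 : ℂ)

/-- `Im ((i/t_k)^(n/2) (erf (y + √(-i t_k)) - erf y)^n)`, principal branches. -/
def coeffA (n k : ℕ) (y : ℝ) : ℝ :=
  ((Complex.I / (freq n k : ℂ)) ^ ((n : ℂ) / 2) *
    (erf ((y : ℂ) + sqrtNegI (freq n k)) - erf (y : ℂ)) ^ n).im

/-- `Im ((i/t_k)^((n-1)/2) (erf (½√(-i t_k)(u+1)) - erf (½√(-i t_k)(u-1)))^n)`,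
principal branches. -/
def coeffB (n k : ℕ) (u : ℝ) : ℝ :=
  ((Complex.I / (freq n k : ℂ)) ^ (((n : ℂ) - 1) / 2) *
    (erf (1 / 2 * sqrtNegI (freq n k) * ((u : ℂ) + 1)) -
      erf (1 / 2 * sqrtNegI (freq n k) * ((u : ℂ) - 1))) ^ n).im

/-- The factor `(1 - cos (t_k x)) / k`. -/
def cosFactor (n k : ℕ) (x : ℝ) : ℝ := (1 - Real.cos (freq n k * x)) / (k : ℝ)

/-- The derivative of `(1 - cos (t_k x)) / k` with respect to `x`. -/
def sinFactor (n k : ℕ) (x : ℝ) : ℝ := freq n k * Real.sin (freq n k * x) / (k : ℝ)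

/-- The integrand `∑_{k ≥ 1} coeffA n k y * (1 - cos (t_k x)) / k` of the first integral. -/
def seriesA (n : ℕ) (x y : ℝ) : ℝ := ∑' k : ℕ, coeffA n (k + 1) y * cosFactor n (k + 1) x

/-- The integrand `∑_{k ≥ 1} coeffB n k u * (1 - cos (t_k x)) / k` of the second integral. -/
def seriesB (n : ℕ) (x u : ℝ) : ℝ := ∑' k : ℕ, coeffB n (k + 1) u * cosFactor n (k + 1) x

/-- The first integrand, differentiated with respect to `x`. -/
def dseriesA (n : ℕ) (x y : ℝ) : ℝ := ∑' k : ℕ, coeffA n (k + 1) y * sinFactor n (k + 1) x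

/-- The second integrand, differentiated with respect to `x`. -/
def dseriesB (n : ℕ) (x u : ℝ) : ℝ := ∑' k : ℕ, coeffB n (k + 1) u * sinFactor n (k + 1) x

/-- The explicit formula for the distribution function. -/
def cdfFormula (n : ℕ) (x : ℝ) : ℝ :=
  1 / 2 * Real.sqrt (n : ℝ) * (Real.sqrt Real.pi / 2) ^ ((n : ℤ) - 3) *
    ((∫ y in Set.Ioi (0 : ℝ), seriesA n x y) + 1 / 2 * ∫ u in (0 : ℝ)..1, seriesB n x u)

/-- The formula obtained from `cdfFormula` by differentiating under the integrals. -/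
def densityFormula (n : ℕ) (x : ℝ) : ℝ :=
  1 / 2 * Real.sqrt (n : ℝ) * (Real.sqrt Real.pi / 2) ^ ((n : ℤ) - 3) *
    ((∫ y in Set.Ioi (0 : ℝ), dseriesA n x y) + 1 / 2 * ∫ u in (0 : ℝ)..1, dseriesB n x u)

end

end UniformSampleVariance

/-!
Write `t = t_k`, `a = √(-it)` and `φ(t) = E exp (i t Q) = E exp (-a² Q)`.

The characteristic function. By Steiner's identity `Q v + n (z - v̄)² = ∑ (v i - z)²`, so for real
`a > 0` a Gaussian integral over `z` turns `E exp (-a² Q)` into the integral over the real line of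
`(∫_0^1 exp (-a² (x - z)²) dx) ^ n`. The integrand is symmetric about `z = 1/2`; its two equal
tails, rescaled by `z = -y / a`, become `∫_0^∞ gaussSeg y a ^ n dy`, and the part over `[0, 1]`
stays as it is. In this form both sides are entire functions of `a`, so the identity holds for
every complex `a` (`integral_exp_neg_sq_mul_Q`): no contour is rotated and no conditionally
convergent integral occurs. At `a = √(-it_k)` the imaginary part is a combination of the integrals
of `coeffA` and `coeffB` (`sinCoeff_lawQ`).

Inversion. For a law on `[0, L]` the sine coefficients `Im φ(kπ/L)` determine the truncated mean
`E min(Q, x)` through the absolutely convergent sine series of `min q x - q x / L`. If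
`∑ |Im φ(kπ/L)| / k` converges, the right derivative in `x` gives `P(Q > x)` on `[0, L)`, and
`P(Q = 0) = 0` fixes the constant (`measureReal_Iic_eq_tsum`). Here `L = Qmax n` is the
maximum of `Q` over the cube, attained at vertices because `Q` is convex in each coordinate.

Convergence. From `|1 - erf z| ≤ |exp (-z²)|` for `Re z ≥ 0` one gets
`|A_k(y)| ≤ C exp (-y²) k ^ (-(n-1)/2)` and `|B_k(u)| ≤ C k ^ (-(n-1)/2)` (`exists_coeff_bound`).
For `n ≥ 3` this dominates the series of the distribution function, and for `n ≥ 4` also the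
differentiated ones, which justifies every interchange of sum, integral and derivative. The density
is continuous, and the law has no mass at `Qmax n`.
-/

namespace UniformSampleVariance

open Complex Set Filter Topology

/-! ### Holomorphic parameter integrals and the error function -/

/-- A parameter integral of entire functions is entire if it is dominated locally uniformly in the
parameter: Cauchy's estimate on discs of radius `1` dominates the derivative as well. -/
theorem differentiable_integral {α : Type*} [TopologicalSpace α] [MeasurableSpace α]
    [OpensMeasurableSpace α] {μ : Measure α} {F : ℂ → α → ℂ}
    (hc : Continuous (Function.uncurry F)) (hd : ∀ x, Differentiable ℂ fun a => F a x)
    (hb : ∀ R : ℝ, ∃ bound : α → ℝ, Integrable bound μ ∧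
      ∀ᵐ x ∂μ, ∀ a : ℂ, ‖a‖ ≤ R → ‖F a x‖ ≤ bound x) :
    Differentiable ℂ fun a => ∫ x, F a x ∂μ := by
  intro a₀
  obtain ⟨bound, hbi, hbd⟩ := hb (‖a₀‖ + 2)
  have hmeas : ∀ a, AEStronglyMeasurable (F a) μ := fun a =>
    ((hc.comp (Continuous.prodMk_right a)).measurable).aestronglyMeasurable
  have hderiv : Measurable fun x => deriv (fun a => F a x) a₀ :=
    (measurable_deriv_with_param (f := fun x a => F a x)
      (hc.comp continuous_swap)).comp measurable_prodMk_right
  refine (hasDerivAt_integral_of_dominated_loc_of_deriv_le (F := F)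
    (F' := fun a x => deriv (fun b => F b x) a) (bound := bound)
    (Metric.ball_mem_nhds a₀ one_pos) (Eventually.of_forall hmeas) ?_
    hderiv.aestronglyMeasurable ?_ hbi ?_).2.differentiableAt
  · exact hbi.mono' (hmeas a₀) (hbd.mono fun x hx => hx a₀ (by linarith))
  · filter_upwards [hbd] with x hx a ha
    have := Complex.norm_deriv_le_of_forall_mem_sphere_norm_le (f := fun b => F b x) (c := a)
      one_pos ((hd x).diffContOnCl) (C := bound x) (fun z hz => hx z ?_)
    · simpa using this
    · rw [mem_sphere_iff_norm] at hz
      rw [mem_ball_iff_norm] at ha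
      have h1 : ‖z‖ ≤ ‖z - a‖ + ‖a - a₀‖ + ‖a₀‖ := by
        calc ‖z‖ = ‖(z - a) + (a - a₀) + a₀‖ := by ring_nf
          _ ≤ _ := norm_add₃_le
      linarith
  · exact Eventually.of_forall fun x a _ => (hd x a).hasDerivAt

theorem differentiable_integral_of_isCompact {α : Type*} [TopologicalSpace α] [MeasurableSpace α]
    [OpensMeasurableSpace α] {μ : Measure α} [IsFiniteMeasure μ] {F : ℂ → α → ℂ}
    {K : Set α} (hK : IsCompact K) (hμ : ∀ᵐ x ∂μ, x ∈ K)
    (hc : Continuous (Function.uncurry F)) (hd : ∀ x, Differentiable ℂ fun a => F a x) :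
    Differentiable ℂ fun a => ∫ x, F a x ∂μ := by
  refine differentiable_integral hc hd fun R => ?_
  obtain ⟨C, hC⟩ := ((isCompact_closedBall (0 : ℂ) R).prod hK).exists_bound_of_continuousOn
    hc.continuousOn
  refine ⟨fun _ => C, integrable_const C, ?_⟩
  filter_upwards [hμ] with x hx a ha
  exact hC (a, x) ⟨by simpa using ha, hx⟩

/-- Two entire functions that agree at all positive real points are equal. -/
theorem eq_of_differentiable_of_eq_ofReal {f g : ℂ → ℂ} (hf : Differentiable ℂ f)
    (hg : Differentiable ℂ g) (h : ∀ r : ℝ, 0 < r → f r = g r) : f = g := by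
  have hfa : AnalyticOnNhd ℂ f univ := fun z _ => hf.analyticAt z
  have hga : AnalyticOnNhd ℂ g univ := fun z _ => hg.analyticAt z
  refine hfa.eq_of_frequently_eq hga (z₀ := 0) ?_
  have ht : Tendsto (fun r : ℝ => (r : ℂ)) (𝓝[>] 0) (𝓝[≠] 0) := by
    refine tendsto_nhdsWithin_iff.2 ⟨?_, ?_⟩
    · exact (Complex.continuous_ofReal.tendsto' 0 0 (by simp)).mono_left nhdsWithin_le_nhds
    · filter_upwards [self_mem_nhdsWithin] with r hr
      simpa using (ne_of_gt hr)
  exact ht.frequently (Eventually.frequently (eventually_mem_nhdsWithin.mono fun r hr => h r hr))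

/-- The integral of the Gaussian over the segment from `z` to `z + w`, divided by `w`. -/
noncomputable def gaussSeg (z w : ℂ) : ℂ := ∫ s in (0 : ℝ)..1, exp (-(z + w * (s : ℂ)) ^ 2)

theorem gaussSeg_eq_setIntegral (z w : ℂ) :
    gaussSeg z w = ∫ s in Icc (0 : ℝ) 1, exp (-(z + w * (s : ℂ)) ^ 2) := by
  rw [gaussSeg, intervalIntegral.integral_of_le zero_le_one, integral_Icc_eq_integral_Ioc]

theorem continuous_gaussSeg : Continuous fun p : ℂ × ℂ => gaussSeg p.1 p.2 := by
  unfold gaussSeg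
  apply intervalIntegral.continuous_parametric_intervalIntegral_of_continuous'
  fun_prop

theorem ae_mem_unitInterval : ∀ᵐ x ∂(volume.restrict (Icc (0 : ℝ) 1)), x ∈ Icc (0 : ℝ) 1 :=
  ae_restrict_mem measurableSet_Icc

theorem differentiable_gaussSeg {z w : ℂ → ℂ} (hz : Differentiable ℂ z) (hw : Differentiable ℂ w) :
    Differentiable ℂ fun a => gaussSeg (z a) (w a) := by
  simp_rw [gaussSeg_eq_setIntegral]
  have h1 := hz.continuous
  have h2 := hw.continuous
  refine differentiable_integral_of_isCompact isCompact_Icc ae_mem_unitInterval ?_ ?_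
  · simp only [Function.uncurry_def]
    fun_prop
  · intro x
    fun_prop

theorem hasDerivAt_erf (z : ℂ) :
    HasDerivAt erf (2 / (Real.sqrt Real.pi : ℂ) * exp (-z ^ 2)) z := by
  obtain ⟨G, hG⟩ := (show Differentiable ℂ fun z : ℂ => exp (-z ^ 2) by fun_prop).isExactOn_univ
  have key : erf = fun z => 2 / (Real.sqrt Real.pi : ℂ) * (G z - G 0) := by
    funext z
    have h : ∀ s ∈ uIcc (0 : ℝ) 1,
        HasDerivAt (fun s : ℝ => G (z * s)) (exp (-(z * s) ^ 2) * z) s := by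
      intro s _
      have h1 : HasDerivAt (fun s : ℝ => z * (s : ℂ)) z s := by
        simpa using (Complex.ofRealCLM.hasDerivAt (x := s)).const_mul z
      exact (hG (z * s) (mem_univ _)).comp s h1
    have := intervalIntegral.integral_eq_sub_of_hasDerivAt h
      (Continuous.intervalIntegrable (by fun_prop) _ _)
    simp only [erf]
    rw [mul_comm z, ← intervalIntegral.integral_mul_const, this]
    simp
  rw [key]
  exact ((hG z (mem_univ _)).sub_const _).const_mul _

theorem differentiable_erf : Differentiable ℂ erf := fun z => (hasDerivAt_erf z).differentiableAt

theorem erf_neg (z : ℂ) : erf (-z) = -erf z := by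
  simp [erf]

theorem erf_sub_erf (z w : ℂ) :
    erf (z + w) - erf z = 2 / (Real.sqrt Real.pi : ℂ) * (w * gaussSeg z w) := by
  have h : ∀ s ∈ uIcc (0 : ℝ) 1, HasDerivAt (fun s : ℝ => erf (z + w * s))
      (2 / (Real.sqrt Real.pi : ℂ) * exp (-(z + w * s) ^ 2) * w) s := by
    intro s _
    have h1 : HasDerivAt (fun s : ℝ => z + w * (s : ℂ)) w s := by
      simpa using ((Complex.ofRealCLM.hasDerivAt (x := s)).const_mul w).const_add z
    exact HasDerivAt.comp (h₂ := erf) s (hasDerivAt_erf (z + w * s)) h1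
  have := intervalIntegral.integral_eq_sub_of_hasDerivAt h
    (Continuous.intervalIntegrable (by fun_prop) _ _)
  simp only [ofReal_one, mul_one, ofReal_zero, mul_zero, add_zero] at this
  rw [← this, intervalIntegral.integral_mul_const, intervalIntegral.integral_const_mul, gaussSeg]
  ring

theorem integrable_exp_neg_sq : Integrable fun y : ℝ => Real.exp (-y ^ 2) := by
  simpa using integrable_exp_neg_mul_sq one_pos

theorem integral_comp_const_add_Ioi (f : ℝ → ℝ) (c a : ℝ) :
    ∫ r in Ioi a, f (c + r) = ∫ w in Ioi (c + a), f w := by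
  have h := (measurePreserving_add_left volume c).setIntegral_preimage_emb
    (measurableEmbedding_addLeft c) f (Ioi (c + a))
  rwa [preimage_const_add_Ioi, add_sub_cancel_left] at h

theorem integrable_exp_neg_sq_add (c : ℝ) :
    Integrable fun r : ℝ => Real.exp (-r ^ 2 + c * r) := by
  have h := (integrable_exp_neg_mul_sq (one_pos)).comp_sub_right (c / 2)
  refine (h.const_mul (Real.exp (c ^ 2 / 4))).congr (Eventually.of_forall fun r => ?_)
  simp only
  rw [← Real.exp_add]
  ring_nf

theorem norm_exp_neg_add_sq_le (z : ℂ) (r : ℝ) :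
    ‖exp (-(z + r) ^ 2)‖ ≤ Real.exp (-r ^ 2 - 2 * z.re * r - (z ^ 2).re) := by
  rw [Complex.norm_exp]
  apply le_of_eq
  simp [pow_two]
  ring

theorem differentiable_integral_exp_neg_add_sq :
    Differentiable ℂ fun z : ℂ => ∫ r in Ioi (0 : ℝ), exp (-(z + r) ^ 2) := by
  refine differentiable_integral (by simp only [Function.uncurry_def]; fun_prop)
    (fun x => by fun_prop) fun R => ?_
  refine ⟨fun r => Real.exp (R ^ 2) * Real.exp (-r ^ 2 + (2 * R) * r),
    ((integrable_exp_neg_sq_add _).const_mul _).integrableOn, ?_⟩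
  filter_upwards [ae_restrict_mem measurableSet_Ioi] with r hr a ha
  refine (norm_exp_neg_add_sq_le a r).trans ?_
  rw [← Real.exp_add, Real.exp_le_exp]
  have h1 : -(a ^ 2).re ≤ R ^ 2 := by
    have : |(a ^ 2).re| ≤ ‖a ^ 2‖ := Complex.abs_re_le_norm _
    rw [norm_pow] at this
    have h2 : ‖a‖ ^ 2 ≤ R ^ 2 := by gcongr
    linarith [neg_abs_le (a ^ 2).re]
  have h2 : -a.re ≤ R := by
    linarith [neg_abs_le a.re, Complex.abs_re_le_norm a]
  have h3 := mul_le_mul_of_nonneg_right h2 (le_of_lt hr)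
  linarith

/-- Both sides are entire, and they agree on the positive reals. -/
theorem one_sub_erf (z : ℂ) :
    1 - erf z = 2 / (Real.sqrt Real.pi : ℂ) * ∫ r in Ioi (0 : ℝ), exp (-(z + r) ^ 2) := by
  refine congrFun (eq_of_differentiable_of_eq_ofReal
    (f := fun z => 1 - erf z)
    (g := fun z => 2 / (Real.sqrt Real.pi : ℂ) * ∫ r in Ioi (0 : ℝ), exp (-(z + r) ^ 2))
    (by have := differentiable_erf; fun_prop)
    (differentiable_integral_exp_neg_add_sq.const_mul _) ?_) z
  intro x hx
  have hsqrt : (Real.sqrt Real.pi) ≠ 0 := by positivity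
  have e1 : erf x = 2 / (Real.sqrt Real.pi : ℂ) * ((∫ w in (0:ℝ)..x, Real.exp (-w ^ 2) : ℝ) : ℂ) := by
    rw [erf]
    congr 1
    have h := intervalIntegral.mul_integral_comp_mul_left (a := (0:ℝ)) (b := 1)
      (f := fun w => Real.exp (-w ^ 2)) (c := x)
    simp only [mul_zero, mul_one] at h
    rw [← h, ofReal_mul, ← intervalIntegral.integral_ofReal]
    simp
  have e2 : (∫ r in Ioi (0 : ℝ), exp (-((x : ℂ) + r) ^ 2)) =
      ((∫ w in Ioi x, Real.exp (-w ^ 2) : ℝ) : ℂ) := by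
    have h := integral_comp_const_add_Ioi (fun w => Real.exp (-w ^ 2)) x 0
    rw [add_zero] at h
    rw [← h, ← integral_complex_ofReal]
    simp
  have e3 : (∫ w in (0:ℝ)..x, Real.exp (-w ^ 2)) + (∫ w in Ioi x, Real.exp (-w ^ 2)) =
      Real.sqrt Real.pi / 2 := by
    have h0 := integrable_exp_neg_sq
    rw [intervalIntegral.integral_interval_add_Ioi h0.integrableOn h0.integrableOn]
    simpa using integral_gaussian_Ioi 1
  rw [e1, e2, sub_eq_iff_eq_add, ← mul_add, add_comm, ← ofReal_add, e3]
  push_cast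
  field_simp

/-- In the right half-plane `1 - erf z` is dominated by the modulus of `exp (-z²)`. This bounds
`erf` on the ray of argument `-π/4`, where `exp (-z²)` merely oscillates. -/
theorem norm_one_sub_erf_le {z : ℂ} (hz : 0 ≤ z.re) :
    ‖1 - erf z‖ ≤ Real.exp (-(z ^ 2).re) := by
  have h0 := integrable_exp_neg_sq
  rw [one_sub_erf, norm_mul]
  have h : ‖∫ r in Ioi (0 : ℝ), exp (-(z + r) ^ 2)‖ ≤
      ∫ r in Ioi (0 : ℝ), Real.exp (-r ^ 2) * Real.exp (-(z ^ 2).re) := by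
    refine norm_integral_le_of_norm_le (h0.mul_const _).integrableOn ?_
    filter_upwards [ae_restrict_mem measurableSet_Ioi] with r hr
    refine (norm_exp_neg_add_sq_le z r).trans ?_
    rw [← Real.exp_add, Real.exp_le_exp]
    have := mul_nonneg hz (le_of_lt hr)
    linarith
  have h1 : ∫ r in Ioi (0 : ℝ), Real.exp (-r ^ 2) = Real.sqrt Real.pi / 2 := by
    simpa using integral_gaussian_Ioi 1
  rw [integral_mul_const, h1] at h
  have hs : 0 < Real.sqrt Real.pi := by positivity
  have h2 : ‖(2 / (Real.sqrt Real.pi : ℂ))‖ = 2 / Real.sqrt Real.pi := by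
    rw [norm_div, Complex.norm_real, Real.norm_of_nonneg hs.le]; simp
  rw [h2]
  calc 2 / Real.sqrt Real.pi * _ ≤ 2 / Real.sqrt Real.pi *
        (Real.sqrt Real.pi / 2 * Real.exp (-(z ^ 2).re)) := by gcongr
    _ = _ := by field_simp

/-! ### The Laplace transform of the sample variance -/

theorem continuous_Q (n : ℕ) : Continuous (Q (n := n)) := by
  unfold Q
  fun_prop

theorem Q_nonneg {n : ℕ} (v : Fin n → ℝ) : 0 ≤ Q v :=
  Finset.sum_nonneg fun _ _ => sq_nonneg _

theorem Q_eq_sum_sq_sub {n : ℕ} (hn : n ≠ 0) (v : Fin n → ℝ) :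
    Q v = ∑ i, v i ^ 2 - (∑ i, v i) ^ 2 / n := by
  have h : (n : ℝ) ≠ 0 := by exact_mod_cast hn
  simp only [Q, sub_sq, Finset.sum_add_distrib, Finset.sum_sub_distrib, ← Finset.sum_mul,
    ← Finset.mul_sum, Finset.sum_const, Finset.card_univ, Fintype.card_fin, nsmul_eq_mul]
  field_simp
  ring

/-- Steiner's identity for the squared distances to a point `z`. -/
theorem Q_add_eq_sum_sq_sub {n : ℕ} (hn : n ≠ 0) (v : Fin n → ℝ) (z : ℝ) :
    Q v + n * (z - (∑ i, v i) / n) ^ 2 = ∑ i, (v i - z) ^ 2 := by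
  have h : (n : ℝ) ≠ 0 := by exact_mod_cast hn
  rw [Q_eq_sum_sq_sub hn]
  simp only [sub_sq, Finset.sum_add_distrib, Finset.sum_sub_distrib, ← Finset.sum_mul,
    ← Finset.mul_sum, Finset.sum_const, Finset.card_univ, Fintype.card_fin, nsmul_eq_mul]
  field_simp
  ring

/-- The uniform distribution on the cube `[0,1]^n`. -/
noncomputable def cubeMeasure (n : ℕ) : Measure (Fin n → ℝ) :=
  Measure.pi fun _ => volume.restrict (Icc (0 : ℝ) 1)

instance : IsProbabilityMeasure ((volume : Measure ℝ).restrict (Icc (0 : ℝ) 1)) :=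
  ⟨by simp⟩

instance (n : ℕ) : IsProbabilityMeasure (cubeMeasure n) := by
  unfold cubeMeasure
  infer_instance

theorem ae_mem_cube (n : ℕ) : ∀ᵐ v ∂cubeMeasure n, v ∈ Icc (0 : Fin n → ℝ) 1 := by
  have h : ∀ i : Fin n, ∀ᵐ v ∂cubeMeasure n, v i ∈ Icc (0 : ℝ) 1 := fun i =>
    (measurePreserving_eval (fun _ : Fin n => volume.restrict (Icc (0 : ℝ) 1))
      i).quasiMeasurePreserving.ae ae_mem_unitInterval
  filter_upwards [ae_all_iff.2 h] with v hv
  exact ⟨fun i => (hv i).1, fun i => (hv i).2⟩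

theorem integrable_exp_neg_mul_sum_sq {n : ℕ} (hn : n ≠ 0) {b : ℝ} (hb : 0 < b) :
    Integrable (fun p : (Fin n → ℝ) × ℝ => Real.exp (-b * ∑ i, (p.1 i - p.2) ^ 2))
      ((cubeMeasure n).prod volume) := by
  have hn' : (0 : ℝ) < n := by positivity
  have hsplit : ∀ v : Fin n → ℝ, ∀ z : ℝ, Real.exp (-b * ∑ i, (v i - z) ^ 2) =
      Real.exp (-b * Q v) * Real.exp (-(b * n) * (z - (∑ i, v i) / n) ^ 2) := by
    intro v z
    rw [← Real.exp_add, ← Q_add_eq_sum_sq_sub hn]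
    ring_nf
  have hm : Measurable fun p : (Fin n → ℝ) × ℝ => Real.exp (-b * ∑ i, (p.1 i - p.2) ^ 2) :=
    Continuous.measurable (by fun_prop)
  refine (integrable_prod_iff hm.aestronglyMeasurable).2 ⟨Eventually.of_forall fun v => ?_, ?_⟩
  · simp only [hsplit]
    exact ((integrable_exp_neg_mul_sq (by positivity)).comp_sub_right _).const_mul _
  · simp only [Real.norm_eq_abs, Real.abs_exp]
    have : ∀ m : ℝ, ∫ z : ℝ, Real.exp (-(b * n) * (z - m) ^ 2) = Real.sqrt (Real.pi / (b * n)) := by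
      intro m
      rw [integral_sub_right_eq_self (fun z : ℝ => Real.exp (-(b * n) * z ^ 2)), integral_gaussian]
    simp only [hsplit, integral_const_mul, this]
    refine Integrable.mul_const ?_ _
    refine Integrable.of_bound (C := 1)
      ((by have := continuous_Q n; fun_prop : Continuous fun v : Fin n → ℝ =>
        Real.exp (-b * Q v)).aestronglyMeasurable) (Eventually.of_forall fun v => ?_)
    rw [Real.norm_eq_abs, Real.abs_exp, Real.exp_le_one_iff]
    have := mul_nonneg hb.le (Q_nonneg v)
    linarith

/-- By Steiner's identity, integrating `exp (-b ∑ (v i - z)²)` over `z` first gives a multiple of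
`exp (-b Q v)`, and integrating over `v` first gives an `n`-th power. -/
theorem integral_exp_neg_mul_Q {n : ℕ} (hn : n ≠ 0) {b : ℝ} (hb : 0 < b) :
    (∫ v, Real.exp (-b * Q v) ∂cubeMeasure n) * Real.sqrt (Real.pi / (b * n)) =
      ∫ z : ℝ, (∫ x in Icc (0 : ℝ) 1, Real.exp (-b * (x - z) ^ 2)) ^ n := by
  have hsplit : ∀ v : Fin n → ℝ, ∫ z : ℝ, Real.exp (-b * ∑ i, (v i - z) ^ 2) =
      Real.exp (-b * Q v) * Real.sqrt (Real.pi / (b * n)) := by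
    intro v
    rw [← integral_gaussian, ← integral_sub_right_eq_self (fun z : ℝ => Real.exp (-(b * n) * z ^ 2))
      ((∑ i, v i) / n), ← integral_const_mul]
    congr 1 with z
    rw [← Real.exp_add, ← Q_add_eq_sum_sq_sub hn]
    ring_nf
  rw [← integral_mul_const]
  simp_rw [← hsplit]
  rw [integral_integral_swap (integrable_exp_neg_mul_sum_sq hn hb)]
  congr 1 with z
  have := integral_fintype_prod_eq_pow (ι := Fin n) (μ := volume.restrict (Icc (0 : ℝ) 1))
    fun x => Real.exp (-b * (x - z) ^ 2)
  rw [Fintype.card_fin] at this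
  rw [← this]
  simp only [Finset.mul_sum, Real.exp_sum]
  rfl

theorem integrable_pow_integral_exp {n : ℕ} (hn : n ≠ 0) {b : ℝ} (hb : 0 < b) :
    Integrable fun z : ℝ => (∫ x in Icc (0 : ℝ) 1, Real.exp (-b * (x - z) ^ 2)) ^ n := by
  refine (integrable_exp_neg_mul_sum_sq hn hb).integral_prod_right.congr
    (Eventually.of_forall fun z => ?_)
  have := integral_fintype_prod_eq_pow (ι := Fin n) (μ := volume.restrict (Icc (0 : ℝ) 1))
    fun x => Real.exp (-b * (x - z) ^ 2)
  rw [Fintype.card_fin] at this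
  simp only [← this, Finset.mul_sum, Real.exp_sum]
  rfl

/-- The two tails of a function symmetric about `1/2` contribute equally. -/
theorem integral_eq_of_symmetric {G : ℝ → ℝ} (hG : Integrable G) (hs : ∀ z, G (1 - z) = G z) :
    ∫ z, G z = 2 * (∫ z in Ioi (0 : ℝ), G (-z)) + ∫ z in (0 : ℝ)..1, G z := by
  have h1 : ∫ z in Ioi (1 : ℝ), G z = ∫ z in Ioi (0 : ℝ), G (-z) := by
    have := integral_comp_const_add_Ioi G 1 0
    rw [add_zero] at this
    rw [← this]
    congr 1 with z
    rw [← hs]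
    ring_nf
  have h2 := integral_comp_neg_Ioi (0 : ℝ) G
  have h3 := intervalIntegral.integral_interval_add_Ioi (hG.integrableOn (s := Ioi 0))
    (hG.integrableOn (s := Ioi 1))
  have h4 := intervalIntegral.integral_Iic_add_Ioi (hG.integrableOn (s := Iic 0))
    (hG.integrableOn (s := Ioi 0))
  rw [neg_zero] at h2
  linarith

theorem integral_exp_unit_symm (b z : ℝ) :
    ∫ x in Icc (0 : ℝ) 1, Real.exp (-b * (x - (1 - z)) ^ 2) =
      ∫ x in Icc (0 : ℝ) 1, Real.exp (-b * (x - z) ^ 2) := by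
  simp only [integral_Icc_eq_integral_Ioc, ← intervalIntegral.integral_of_le zero_le_one]
  have := intervalIntegral.integral_comp_sub_left (a := 0) (b := 1)
    (fun x : ℝ => Real.exp (-b * (x - z) ^ 2)) 1
  simp only [sub_self, sub_zero] at this
  rw [← this]
  congr 1 with x
  ring_nf

theorem ofReal_integral_exp_eq_gaussSeg (a z : ℝ) :
    ((∫ x in Icc (0 : ℝ) 1, Real.exp (-a ^ 2 * (x - z) ^ 2) : ℝ) : ℂ) =
      gaussSeg (-((a : ℂ) * z)) a := by
  rw [gaussSeg_eq_setIntegral, ← integral_complex_ofReal]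
  congr 1 with x
  push_cast
  ring_nf

theorem norm_gaussSeg_le {R y : ℝ} (hR : 0 ≤ R) (hy : 0 ≤ y) {a : ℂ} (ha : ‖a‖ ≤ R) :
    ‖gaussSeg y a‖ ≤ Real.exp (-y ^ 2 + 2 * R * y + R ^ 2) := by
  rw [gaussSeg]
  have := intervalIntegral.norm_integral_le_of_norm_le_const (a := 0) (b := 1)
    (f := fun s : ℝ => exp (-((y : ℂ) + a * s) ^ 2))
    (C := Real.exp (-y ^ 2 + 2 * R * y + R ^ 2)) ?_
  · simpa using this
  · intro s hs
    rw [uIoc_of_le zero_le_one] at hs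
    rw [Complex.norm_exp, Real.exp_le_exp]
    have has : ‖a * s‖ ≤ R := by
      rw [norm_mul, Complex.norm_real, Real.norm_of_nonneg hs.1.le]
      nlinarith [norm_nonneg a, hs.1, hs.2]
    have h1 : -((a * s) ^ 2).re ≤ R ^ 2 := by
      have : |((a * s) ^ 2).re| ≤ ‖(a * s) ^ 2‖ := Complex.abs_re_le_norm _
      rw [norm_pow] at this
      have h2 : ‖a * s‖ ^ 2 ≤ R ^ 2 := by gcongr
      linarith [neg_abs_le ((a * s) ^ 2).re]
    have h2 : -(a * s).re ≤ R := by
      linarith [neg_abs_le (a * s).re, Complex.abs_re_le_norm (a * s)]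
    have h3 := mul_le_mul_of_nonneg_right h2 hy
    have h4 : (-((y : ℂ) + a * s) ^ 2).re = -y ^ 2 - 2 * y * (a * s).re - ((a * s) ^ 2).re := by
      rw [add_sq]
      simp [pow_two]
      ring
    rw [h4]
    linarith

theorem norm_gaussSeg_pow_le {n : ℕ} (hn : n ≠ 0) {R y : ℝ} (hR : 0 ≤ R) (hy : 0 ≤ y) {a : ℂ}
    (ha : ‖a‖ ≤ R) :
    ‖gaussSeg y a ^ n‖ ≤ Real.exp (n * R ^ 2) * Real.exp (-y ^ 2 + (2 * n * R) * y) := by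
  rw [norm_pow]
  calc _ ≤ (Real.exp (-y ^ 2 + 2 * R * y + R ^ 2)) ^ n := by
        gcongr
        exact norm_gaussSeg_le hR hy ha
    _ ≤ _ := by
        rw [← Real.exp_nat_mul, ← Real.exp_add, Real.exp_le_exp]
        have h1 : (1 : ℝ) ≤ n := by exact_mod_cast Nat.one_le_iff_ne_zero.2 hn
        nlinarith [sq_nonneg y]

theorem differentiable_integral_Ioi_gaussSeg_pow {n : ℕ} (hn : n ≠ 0) :
    Differentiable ℂ fun a : ℂ => ∫ y in Ioi (0 : ℝ), gaussSeg y a ^ n := by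
  have hc : Continuous (Function.uncurry fun (a : ℂ) (y : ℝ) => gaussSeg y a ^ n) :=
    (continuous_gaussSeg.comp (by fun_prop : Continuous fun p : ℂ × ℝ => ((p.2 : ℂ), p.1))).pow n
  refine differentiable_integral hc
    (fun y => (differentiable_gaussSeg (differentiable_const _) differentiable_id).pow n)
    fun R => ?_
  wlog hR : 0 ≤ R generalizing R
  · obtain ⟨bound, h1, h2⟩ := this 0 le_rfl
    exact ⟨bound, h1, h2.mono fun x hx a ha => hx a (ha.trans (by linarith))⟩
  refine ⟨fun y => Real.exp (n * R ^ 2) * Real.exp (-y ^ 2 + (2 * n * R) * y),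
    ((integrable_exp_neg_sq_add _).const_mul _).integrableOn, ?_⟩
  filter_upwards [ae_restrict_mem measurableSet_Ioi] with y hy a ha
  exact norm_gaussSeg_pow_le hn hR (le_of_lt hy) ha

/-- Completing the square turns `exp (-a² Q)` into a Gaussian mixture of product functions; the
formula holds for every complex `a` by analytic continuation from the positive reals. -/
theorem integral_exp_neg_sq_mul_Q {n : ℕ} (hn : n ≠ 0) (a : ℂ) :
    ∫ v, exp (-(a ^ 2 * Q v)) ∂cubeMeasure n =
      (Real.sqrt (n / Real.pi) : ℂ) * (2 * (∫ y in Ioi (0 : ℝ), gaussSeg y a ^ n) +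
        a * ∫ z in (0 : ℝ)..1, gaussSeg (-(a * z)) a ^ n) := by
  have hn' : (0 : ℝ) < n := by positivity
  refine congrFun (eq_of_differentiable_of_eq_ofReal
    (f := fun a : ℂ => ∫ v, exp (-(a ^ 2 * Q v)) ∂cubeMeasure n)
    (g := fun a : ℂ => (Real.sqrt (n / Real.pi) : ℂ) *
      (2 * (∫ y in Ioi (0 : ℝ), gaussSeg y a ^ n) +
        a * ∫ z in (0 : ℝ)..1, gaussSeg (-(a * z)) a ^ n)) ?_ ?_ ?_) a
  · have := continuous_Q n
    refine differentiable_integral_of_isCompact isCompact_Icc (ae_mem_cube n) ?_ fun v => ?_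
    · simp only [Function.uncurry_def]
      fun_prop
    · fun_prop
  · simp only [intervalIntegral.integral_of_le zero_le_one, ← integral_Icc_eq_integral_Ioc]
    have h1 := differentiable_integral_Ioi_gaussSeg_pow hn
    have h2 : Differentiable ℂ fun a : ℂ => ∫ z in Icc (0 : ℝ) 1, gaussSeg (-(a * z)) a ^ n :=
      differentiable_integral_of_isCompact isCompact_Icc ae_mem_unitInterval
        ((continuous_gaussSeg.comp
          (by fun_prop : Continuous fun p : ℂ × ℝ => (-(p.1 * (p.2 : ℂ)), p.1))).pow n)
        fun z => (differentiable_gaussSeg (by fun_prop) differentiable_id).pow n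
    fun_prop
  · intro r hr
    have key := integral_exp_neg_mul_Q hn (pow_pos hr 2)
    rw [integral_eq_of_symmetric (integrable_pow_integral_exp hn (pow_pos hr 2))
      (fun z => by rw [integral_exp_unit_symm])] at key
    -- the left tail is rescaled by `z = -y / r`
    have hscale := integral_comp_mul_left_Ioi
      (fun y : ℝ => (∫ x in Icc (0 : ℝ) 1, Real.exp (-r ^ 2 * (x - -y) ^ 2)) ^ n) 0
      (inv_pos.2 hr)
    rw [mul_zero, inv_inv, smul_eq_mul] at hscale
    have hI : (∫ v, exp (-((r : ℂ) ^ 2 * Q v)) ∂cubeMeasure n) =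
        ((∫ v, Real.exp (-r ^ 2 * Q v) ∂cubeMeasure n : ℝ) : ℂ) := by
      rw [← integral_complex_ofReal]
      congr 1 with v
      push_cast
      ring_nf
    have hJ : (∫ y in Ioi (0 : ℝ), gaussSeg y r ^ n) =
        (r : ℂ) * ((∫ z in Ioi (0 : ℝ),
          (∫ x in Icc (0 : ℝ) 1, Real.exp (-r ^ 2 * (x - -z) ^ 2)) ^ n : ℝ) : ℂ) := by
      rw [← ofReal_mul, ← hscale, ← integral_complex_ofReal]
      congr 1 with y
      rw [ofReal_pow, ofReal_integral_exp_eq_gaussSeg]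
      congr 2
      have hr0 : (r : ℂ) ≠ 0 := by exact_mod_cast hr.ne'
      push_cast
      field_simp
    have hK : (∫ z in (0 : ℝ)..1, gaussSeg (-((r : ℂ) * z)) r ^ n) =
        ((∫ z in (0 : ℝ)..1,
          (∫ x in Icc (0 : ℝ) 1, Real.exp (-r ^ 2 * (x - z) ^ 2)) ^ n : ℝ) : ℂ) := by
      rw [← intervalIntegral.integral_ofReal]
      simp only [ofReal_pow, ofReal_integral_exp_eq_gaussSeg]
    rw [hI, hJ, hK]
    have hs : Real.sqrt (n / Real.pi) * r * Real.sqrt (Real.pi / (r ^ 2 * n)) = 1 := by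
      have h1 : Real.sqrt (Real.pi / (r ^ 2 * n)) = (r * Real.sqrt (n / Real.pi))⁻¹ := by
        rw [show Real.pi / (r ^ 2 * n) = (r ^ 2 * (n / Real.pi))⁻¹ by field_simp,
          Real.sqrt_inv, Real.sqrt_mul (by positivity), Real.sqrt_sq hr.le]
      rw [h1]
      have : Real.sqrt (n / Real.pi) ≠ 0 := by positivity
      field_simp
    norm_cast
    linear_combination (Real.sqrt (n / Real.pi) * r) * key -
      (∫ v, Real.exp (-r ^ 2 * Q v) ∂cubeMeasure n) * hs

end UniformSampleVariance

namespace UniformSampleVariance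

open Set Filter Topology

/-! ### The range of the sample variance -/

/-- Strict convexity of `Q` in each coordinate. -/
theorem Q_lt_max_update {n : ℕ} (hn : 2 ≤ n) (v : Fin n → ℝ) (i : Fin n) (hi : v i ∈ Ioo (0 : ℝ) 1) :
    Q v < max (Q (Function.update v i 0)) (Q (Function.update v i 1)) := by
  have hn' : (2 : ℝ) ≤ n := by exact_mod_cast hn
  obtain ⟨A, B, h⟩ : ∃ A B : ℝ, ∀ x, Q (Function.update v i x) = x ^ 2 + A - (x + B) ^ 2 / n := by
    refine ⟨∑ j ∈ Finset.univ \ {i}, v j ^ 2, ∑ j ∈ Finset.univ \ {i}, v j, fun x => ?_⟩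
    rw [Q_eq_sum_sq_sub (by lia), Finset.sum_update_of_mem (Finset.mem_univ i)]
    congr 1
    rw [Finset.sum_eq_sum_sdiff_singleton_add (Finset.mem_univ i), Function.update_self, add_comm]
    congr 1
    refine Finset.sum_congr rfl fun j hj => ?_
    rw [Function.update_of_ne (by simpa using hj)]
  rw [← Function.update_eq_self i v]
  generalize v i = x at hi
  by_contra hcon
  rw [not_lt, max_le_iff] at hcon
  simp only [Function.update_idem, h] at hcon
  obtain ⟨h0, h1⟩ := hcon
  have hx := mul_pos hi.1 (sub_pos.2 hi.2)
  -- the convexity defect of a quadratic polynomial with leading coefficient `1 - 1 / n`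
  have e : (1 - x) * ((0:ℝ) ^ 2 + A - (0 + B) ^ 2 / n) + x * (1 ^ 2 + A - (1 + B) ^ 2 / n) -
    (x ^ 2 + A - (x + B) ^ 2 / n) = (x * (1 - x)) * (1 - 1 / n) := by field_simp; ring
  have h2 : (0 : ℝ) < 1 - 1 / n := by
    rw [sub_pos, div_lt_one (by linarith)]; linarith
  nlinarith [mul_pos hx h2, mul_le_mul_of_nonneg_left h0 (sub_pos.2 hi.2).le,
    mul_le_mul_of_nonneg_left h1 hi.1.le]

theorem Q_le_Qmax_of_vertex {n : ℕ} (hn : 2 ≤ n) (w : Fin n → ℝ) (hw : ∀ i, w i = 0 ∨ w i = 1) :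
    Q w ≤ Qmax n := by
  have hn' : (0 : ℝ) < n := by positivity
  rw [Q_eq_sum_sq_sub (by lia)]
  have h1 : ∑ i, w i ^ 2 = ∑ i, w i :=
    Finset.sum_congr rfl fun i _ => by rcases hw i with h | h <;> simp [h]
  obtain ⟨m, hm⟩ : ∃ m : ℕ, ∑ i, w i = m := by
    refine ⟨∑ i, if w i = 0 then 0 else 1, ?_⟩
    push_cast
    exact Finset.sum_congr rfl fun i _ => by rcases hw i with h | h <;> simp [h]
  rw [h1, hm, Qmax]
  split_ifs with he
  · rw [← sub_nonneg]
    have : (n : ℝ) / 4 - (m - (m : ℝ) ^ 2 / n) = (m - n / 2 : ℝ) ^ 2 / n := by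
      field_simp
      ring
    rw [this]
    positivity
  · obtain ⟨j, hj⟩ := Nat.not_even_iff_odd.1 he
    have hj' : (n : ℝ) = 2 * j + 1 := by exact_mod_cast hj
    -- no integer lies strictly between `j` and `j + 1`
    have hi : 0 ≤ ((m : ℤ) - j) * ((m : ℤ) - j - 1) := by
      rcases le_or_gt (m : ℤ) j with h | h
      · exact mul_nonneg_of_nonpos_of_nonpos (by lia) (by lia)
      · exact mul_nonneg (by lia) (by lia)
    have hi' : (0 : ℝ) ≤ ((m : ℝ) - j) * ((m : ℝ) - j - 1) := by exact_mod_cast hi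
    rw [← sub_nonneg]
    have : ((n : ℝ) ^ 2 - 1) / (4 * n) - (m - (m : ℝ) ^ 2 / n) =
        ((m : ℝ) - j) * ((m : ℝ) - j - 1) / n := by
      field_simp
      rw [hj']
      ring
    rw [this]
    positivity

/-- `Q` is convex in each coordinate, so its maximum over the cube is attained at a vertex. -/
theorem Q_le_Qmax {n : ℕ} (hn : 2 ≤ n) (v : Fin n → ℝ) (hv : ∀ i, v i ∈ Icc (0 : ℝ) 1) :
    Q v ≤ Qmax n := by
  have key : ∀ s : Finset (Fin n), ∃ w : Fin n → ℝ, (∀ i ∈ s, w i = 0 ∨ w i = 1) ∧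
      (∀ i, w i ∈ Icc (0 : ℝ) 1) ∧ Q v ≤ Q w := by
    intro s
    induction s using Finset.induction_on with
    | empty => exact ⟨v, by simp, hv, le_rfl⟩
    | insert i s _ ih =>
      obtain ⟨w, h1, h2, h3⟩ := ih
      by_cases hi : w i = 0 ∨ w i = 1
      · exact ⟨w, fun j hj => (Finset.mem_insert.1 hj).elim (fun h => h ▸ hi) (h1 j), h2, h3⟩
      · rw [not_or] at hi
        have hup : ∀ c : ℝ, c = 0 ∨ c = 1 → Q v ≤ Q (Function.update w i c) →
            ∃ w : Fin n → ℝ, (∀ j ∈ insert i s, w j = 0 ∨ w j = 1) ∧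
              (∀ i, w i ∈ Icc (0 : ℝ) 1) ∧ Q v ≤ Q w := by
          intro c hc hQ
          refine ⟨_, fun j hj => ?_, fun j => ?_, hQ⟩
          · rcases eq_or_ne j i with rfl | hji
            · simpa using hc
            · rw [Function.update_of_ne hji]
              exact h1 j ((Finset.mem_insert.1 hj).resolve_left hji)
          · rcases eq_or_ne j i with rfl | hji
            · rw [Function.update_self]
              rcases hc with rfl | rfl <;> simp
            · rw [Function.update_of_ne hji]
              exact h2 j
        have := Q_lt_max_update hn w i
          ⟨lt_of_le_of_ne (h2 i).1 (Ne.symm hi.1), lt_of_le_of_ne (h2 i).2 hi.2⟩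
        rcases lt_max_iff.1 this with h | h
        · exact hup 0 (Or.inl rfl) (h3.trans h.le)
        · exact hup 1 (Or.inr rfl) (h3.trans h.le)
  obtain ⟨w, h1, -, h3⟩ := key Finset.univ
  exact h3.trans (Q_le_Qmax_of_vertex hn w fun i => h1 i (Finset.mem_univ i))

theorem Q_lt_Qmax {n : ℕ} (hn : 2 ≤ n) (v : Fin n → ℝ) (hv : ∀ i, v i ∈ Icc (0 : ℝ) 1) (i : Fin n)
    (hi : v i ∈ Ioo (0 : ℝ) 1) : Q v < Qmax n := by
  have hup : ∀ c ∈ Icc (0 : ℝ) 1, Q (Function.update v i c) ≤ Qmax n := by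
    intro c hc
    refine Q_le_Qmax hn _ fun j => ?_
    rcases eq_or_ne j i with rfl | hji
    · rwa [Function.update_self]
    · rw [Function.update_of_ne hji]
      exact hv j
  exact (Q_lt_max_update hn v i hi).trans_le (max_le (hup 0 (by simp)) (hup 1 (by simp)))

theorem cubeMeasure_eq_restrict (n : ℕ) :
    cubeMeasure n = volume.restrict (univ.pi fun _ : Fin n => Icc (0 : ℝ) 1) := by
  rw [cubeMeasure, volume_pi, Measure.restrict_pi_pi]

/-- `Q` attains `Qmax` only if no coordinate lies in the open interval `(0, 1)`. -/
theorem ae_Q_lt_Qmax {n : ℕ} (hn : 2 ≤ n) : ∀ᵐ v ∂cubeMeasure n, Q v < Qmax n := by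
  let i : Fin n := ⟨0, by lia⟩
  have h : ∀ᵐ v ∂cubeMeasure n, v i ∈ Ioo (0 : ℝ) 1 := by
    refine (measurePreserving_eval (fun _ : Fin n => volume.restrict (Icc (0 : ℝ) 1))
      i).quasiMeasurePreserving.ae (p := fun x => x ∈ Ioo (0 : ℝ) 1) ?_
    rw [restrict_Ioo_eq_restrict_Icc.symm]
    exact ae_restrict_mem measurableSet_Ioo
  filter_upwards [h, ae_mem_cube n] with v hv hc
  exact Q_lt_Qmax hn v (fun j => ⟨hc.1 j, hc.2 j⟩) i hv

/-- `Q v = 0` forces the first two coordinates to agree, which confines `v` to a hyperplane. -/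
theorem ae_Q_ne_zero {n : ℕ} (hn : 2 ≤ n) : ∀ᵐ v ∂cubeMeasure n, Q v ≠ 0 := by
  let i : Fin n := ⟨0, by lia⟩
  let j : Fin n := ⟨1, by lia⟩
  let S : Submodule ℝ (Fin n → ℝ) := LinearMap.ker
    (LinearMap.proj (R := ℝ) (φ := fun _ : Fin n => ℝ) i -
      LinearMap.proj (R := ℝ) (φ := fun _ : Fin n => ℝ) j)
  have hS : S ≠ ⊤ := by
    intro h
    have : (Pi.single i 1 : Fin n → ℝ) ∈ S := h ▸ Submodule.mem_top
    have hij : j ≠ i := by simp [i, j]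
    simp [S, LinearMap.mem_ker, hij] at this
  have h := Measure.addHaar_submodule (volume : Measure (Fin n → ℝ)) S hS
  rw [cubeMeasure_eq_restrict]
  refine ae_restrict_of_ae ?_
  filter_upwards [measure_eq_zero_iff_ae_notMem.1 h] with v hv hQ
  refine hv ?_
  rw [Q, Finset.sum_eq_zero_iff_of_nonneg fun _ _ => sq_nonneg _] at hQ
  have hi := pow_eq_zero_iff two_ne_zero |>.1 (hQ i (Finset.mem_univ _))
  have hj := pow_eq_zero_iff two_ne_zero |>.1 (hQ j (Finset.mem_univ _))
  simp only [S, SetLike.mem_coe, LinearMap.mem_ker, LinearMap.sub_apply, LinearMap.proj_apply]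
  linarith

theorem Qmax_pos {n : ℕ} (hn : 2 ≤ n) : 0 < Qmax n := by
  have hn' : (2 : ℝ) ≤ n := by exact_mod_cast hn
  rw [Qmax]
  split_ifs
  · positivity
  · have : (0 : ℝ) < (n : ℝ) ^ 2 - 1 := by nlinarith
    positivity

theorem freq_succ {n : ℕ} (hn : 2 ≤ n) (k : ℕ) :
    freq n (k + 1) = (k + 1) * Real.pi / Qmax n := by
  have hn' : (2 : ℝ) ≤ n := by exact_mod_cast hn
  rw [Qmax, freq]
  split_ifs
  · push_cast
    field_simp
  · have : (0 : ℝ) < (n : ℝ) ^ 2 - 1 := by nlinarith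
    push_cast
    field_simp

theorem freq_succ_pos {n : ℕ} (hn : 2 ≤ n) (k : ℕ) : 0 < freq n (k + 1) := by
  rw [freq_succ hn]
  have := Qmax_pos hn
  positivity

/-! ### Fourier inversion for laws on a bounded interval -/

/-- The Fourier sine expansion of `min q x - q x / L`, obtained from the absolutely convergent cosine
series of the second Bernoulli polynomial. -/
theorem hasSum_sin_mul_sin {L q x : ℝ} (hL : 0 < L) (hq : q ∈ Icc 0 L) (hx : x ∈ Icc 0 L) :
    HasSum (fun k : ℕ => Real.sin ((k + 1) * Real.pi / L * q) *
        Real.sin ((k + 1) * Real.pi / L * x) / ((k : ℝ) + 1) ^ 2)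
      (Real.pi ^ 2 / (2 * L) * (min q x - q * x / L)) := by
  have key : ∀ y ∈ Icc (0 : ℝ) 1, HasSum (fun k : ℕ => 1 / ((k : ℝ) + 1) ^ 2 *
      Real.cos (2 * Real.pi * (k + 1) * y)) (Real.pi ^ 2 * (y ^ 2 - y + 6⁻¹)) := by
    intro y hy
    have h := hasSum_one_div_nat_pow_mul_cos one_ne_zero hy
    -- the term of index `0` vanishes because `1 / 0 = 0`
    rw [← hasSum_nat_add_iff' 1] at h
    convert! h using 1
    · ext k
      push_cast
      ring_nf
    · have := bernoulliFun_two y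
      rw [bernoulliFun] at this
      have hf : ((2 : ℕ).factorial : ℝ) = 2 := by norm_num [Nat.factorial]
      rw [mul_one, this, hf, Finset.sum_range_one, Nat.cast_zero,
        show (0 : ℝ) ^ (2 * 1) = 0 by norm_num, div_zero, zero_mul]
      ring
  have h1 := key (|q - x| / (2 * L)) ⟨by positivity, by
    rw [div_le_one (by positivity), abs_le]
    constructor <;> linarith [hq.1, hq.2, hx.1, hx.2]⟩
  have h2 := key ((q + x) / (2 * L)) ⟨by have := hq.1; have := hx.1; positivity, by
    rw [div_le_one (by positivity)]
    linarith [hq.2, hx.2]⟩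
  convert! (h1.sub h2).mul_left (1 / 2) using 1
  · ext k
    have e1 : Real.cos (2 * Real.pi * (k + 1) * (|q - x| / (2 * L))) =
        Real.cos ((k + 1) * Real.pi / L * q - (k + 1) * Real.pi / L * x) := by
      rw [← mul_sub, ← Real.cos_abs ((k + 1) * Real.pi / L * (q - x)), abs_mul,
        abs_of_nonneg (show 0 ≤ (k + 1) * Real.pi / L by positivity)]
      congr 1
      field_simp
    have e2 : Real.cos (2 * Real.pi * (k + 1) * ((q + x) / (2 * L))) =
        Real.cos ((k + 1) * Real.pi / L * q + (k + 1) * Real.pi / L * x) := by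
      congr 1
      field_simp
    rw [e1, e2, Real.cos_sub, Real.cos_add]
    ring
  · rcases le_total q x with h | h
    · rw [min_eq_left h, abs_of_nonpos (by linarith)]
      field_simp
      ring
    · rw [min_eq_right h, abs_of_nonneg (by linarith)]
      field_simp
      ring

/-- The sine coefficients of a measure on `[0, L]`. -/
noncomputable def sinCoeff (ν : Measure ℝ) (L : ℝ) (k : ℕ) : ℝ :=
  ∫ q, Real.sin ((k + 1) * Real.pi / L * q) ∂ν

theorem integrable_of_ae_mem_Icc {ν : Measure ℝ} [IsFiniteMeasure ν] {L : ℝ}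
    (hν : ∀ᵐ q ∂ν, q ∈ Icc 0 L) {f : ℝ → ℝ} (hf : Continuous f) : Integrable f ν := by
  obtain ⟨C, hC⟩ := (isCompact_Icc (a := (0 : ℝ)) (b := L)).exists_bound_of_continuousOn
    hf.continuousOn
  exact Integrable.of_bound hf.aestronglyMeasurable C (hν.mono fun q hq => hC q hq)

theorem summable_one_div_succ_sq : Summable fun k : ℕ => 1 / ((k : ℝ) + 1) ^ 2 := by
  have := (summable_nat_add_iff 1).2 (Real.summable_one_div_nat_pow.2 one_lt_two)
  simpa using this

theorem integral_min_sub_eq_tsum {ν : Measure ℝ} [IsProbabilityMeasure ν] {L x : ℝ} (hL : 0 < L)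
    (hν : ∀ᵐ q ∂ν, q ∈ Icc 0 L) (hx : x ∈ Icc 0 L) :
    (∫ q, min q x ∂ν) - x * (∫ q, q ∂ν) / L =
      2 / Real.pi * ∑' k : ℕ, sinCoeff ν L k / (k + 1) *
        (Real.sin ((k + 1) * Real.pi / L * x) / ((k + 1) * Real.pi / L)) := by
  have h := hasSum_integral_of_dominated_convergence (μ := ν)
    (F := fun (k : ℕ) q => Real.sin ((k + 1) * Real.pi / L * q) *
        Real.sin ((k + 1) * Real.pi / L * x) / ((k : ℝ) + 1) ^ 2)
    (f := fun q => Real.pi ^ 2 / (2 * L) * (min q x - q * x / L))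
    (fun k _ => 1 / ((k : ℝ) + 1) ^ 2)
    (fun k => Continuous.aestronglyMeasurable (by fun_prop))
    (fun k => Eventually.of_forall fun q => ?_)
    (Eventually.of_forall fun _ => summable_one_div_succ_sq) (integrable_const _)
    (hν.mono fun q hq => hasSum_sin_mul_sin hL hq hx)
  · rw [integral_const_mul, integral_sub (integrable_of_ae_mem_Icc hν (by fun_prop))
      (integrable_of_ae_mem_Icc hν (by fun_prop)), integral_div, integral_mul_const] at h
    rw [mul_comm x, ← mul_right_inj' (show Real.pi ^ 2 / (2 * L) ≠ 0 by positivity), ← h.tsum_eq,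
      ← mul_assoc, ← tsum_mul_left]
    congr 1 with k
    rw [integral_div, integral_mul_const, sinCoeff]
    field_simp
  · rw [norm_div, norm_mul, Real.norm_eq_abs, Real.norm_eq_abs, Real.norm_of_nonneg (by positivity)]
    gcongr
    exact mul_le_one₀ (Real.abs_sin_le_one _) (abs_nonneg _) (Real.abs_sin_le_one _)

/-- The right derivative of the truncated mean is the tail probability. -/
theorem hasDerivWithinAt_integral_min {ν : Measure ℝ} [IsProbabilityMeasure ν]
    (hi : ∀ x : ℝ, Integrable (fun q => min q x) ν) (x : ℝ) :
    HasDerivWithinAt (fun y => ∫ q, min q y ∂ν) (ν.real (Ioi x)) (Ioi x) x := by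
  rw [hasDerivWithinAt_iff_tendsto_slope' self_notMem_Ioi,
    ← integral_indicator_one measurableSet_Ioi]
  have hsl : ∀ y, slope (fun y => ∫ q, min q y ∂ν) x y =
      ∫ q, (y - x)⁻¹ * (min q y - min q x) ∂ν := by
    intro y
    rw [integral_const_mul, integral_sub (hi y) (hi x), slope_def_field, div_eq_inv_mul]
  refine Tendsto.congr (fun y => (hsl y).symm) ?_
  refine tendsto_integral_filter_of_dominated_convergence (fun _ => 1)
    (Eventually.of_forall fun y => Continuous.aestronglyMeasurable (by fun_prop)) ?_
    (integrable_const _) (Eventually.of_forall fun q => ?_)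
  · filter_upwards [self_mem_nhdsWithin] with y hy
    refine Eventually.of_forall fun q => ?_
    have hy' : 0 < y - x := sub_pos.2 hy
    rw [norm_mul, norm_inv, Real.norm_of_nonneg hy'.le, inv_mul_le_one₀ hy', Real.norm_eq_abs]
    have := abs_min_sub_min_le_max q y q x
    rw [sub_self, abs_zero, max_eq_right (abs_nonneg _), abs_of_pos hy'] at this
    exact this
  · by_cases hq : x < q
    · refine tendsto_const_nhds.congr' ?_
      filter_upwards [Ioo_mem_nhdsGT hq] with y hy
      rw [min_eq_right hy.2.le, min_eq_right hq.le, inv_mul_cancel₀ (sub_pos.2 hy.1).ne',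
        indicator_of_mem (show q ∈ Ioi x from hq), Pi.one_apply]
    · refine tendsto_const_nhds.congr' ?_
      filter_upwards [self_mem_nhdsWithin] with y hy
      have hq' : q ≤ x := not_lt.1 hq
      rw [min_eq_left hq', min_eq_left (hq'.trans (le_of_lt hy)), sub_self, mul_zero,
        indicator_of_notMem (show q ∉ Ioi x from hq)]

/-- The right derivative of the expansion of the truncated mean. One-sided derivatives make it hold
at every `x`, atoms included, and at the endpoint `0`. -/
theorem measureReal_Ioi_eq_tsum {ν : Measure ℝ} [IsProbabilityMeasure ν] {L x : ℝ} (hL : 0 < L)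
    (hν : ∀ᵐ q ∂ν, q ∈ Icc 0 L) (hs : Summable fun k : ℕ => |sinCoeff ν L k| / (k + 1))
    (hx : x ∈ Ico 0 L) :
    ν.real (Ioi x) = (∫ q, q ∂ν) / L + 2 / Real.pi * ∑' k : ℕ, sinCoeff ν L k / (k + 1) *
      Real.cos ((k + 1) * Real.pi / L * x) := by
  have hM := hasDerivWithinAt_integral_min
    (fun y => integrable_of_ae_mem_Icc hν (by fun_prop : Continuous fun q => min q y)) x
  have hM' := hM.sub (((hasDerivWithinAt_id x (Ioi x)).mul_const (∫ q, q ∂ν)).div_const L)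
  have hH : HasDerivAt (fun y => ∑' k : ℕ, sinCoeff ν L k / (k + 1) *
        (Real.sin ((k + 1) * Real.pi / L * y) / ((k + 1) * Real.pi / L)))
      (∑' k : ℕ, sinCoeff ν L k / (k + 1) * Real.cos ((k + 1) * Real.pi / L * x)) x := by
    refine hasDerivAt_tsum (y₀ := 0) hs
      (g := fun (k : ℕ) (y : ℝ) => sinCoeff ν L k / (k + 1) *
        (Real.sin ((k + 1) * Real.pi / L * y) / ((k + 1) * Real.pi / L)))
      (g' := fun (k : ℕ) (y : ℝ) => sinCoeff ν L k / (k + 1) *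
        Real.cos ((k + 1) * Real.pi / L * y)) (fun k y => ?_) (fun k y => ?_) (by simp) x
    · have hc : ((k : ℝ) + 1) * Real.pi / L ≠ 0 := by positivity
      have h1 : HasDerivAt (fun y : ℝ => ((k : ℝ) + 1) * Real.pi / L * y)
          (((k : ℝ) + 1) * Real.pi / L) y := by
        simpa using (hasDerivAt_id y).const_mul (((k : ℝ) + 1) * Real.pi / L)
      have h2 := (h1.sin.div_const (((k : ℝ) + 1) * Real.pi / L)).const_mul
        (sinCoeff ν L k / (k + 1))
      rwa [mul_div_cancel_right₀ _ hc] at h2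
    · rw [norm_mul, norm_div, Real.norm_eq_abs, Real.norm_eq_abs,
        abs_of_nonneg (show (0 : ℝ) ≤ k + 1 by positivity)]
      exact mul_le_of_le_one_right (by positivity) (Real.abs_cos_le_one _)
  have hH' := (hH.const_mul (2 / Real.pi)).hasDerivWithinAt (s := Ioi x)
  have heq : ∀ y ∈ Icc 0 L, (∫ q, min q y ∂ν) - y * (∫ q, q ∂ν) / L = _ :=
    fun y hy => integral_min_sub_eq_tsum hL hν hy
  have hH'' := hH'.congr_of_eventuallyEq (f₁ := fun y => (∫ q, min q y ∂ν) - y * (∫ q, q ∂ν) / L)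
    (by filter_upwards [Ioo_mem_nhdsGT hx.2] with y hy
        exact heq y ⟨hx.1.trans hy.1.le, hy.2.le⟩) (heq x ⟨hx.1, hx.2.le⟩)
  have := (uniqueDiffWithinAt_Ioi x).eq_deriv _ hM' hH''
  rw [one_mul] at this
  linarith

theorem measureReal_Iic_eq_tsum {ν : Measure ℝ} [IsProbabilityMeasure ν] {L x : ℝ} (hL : 0 < L)
    (hν : ∀ᵐ q ∂ν, q ∈ Icc 0 L) (h0 : ν {0} = 0)
    (hs : Summable fun k : ℕ => |sinCoeff ν L k| / (k + 1)) (hx : x ∈ Ico 0 L) :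
    ν.real (Iic x) = 2 / Real.pi * ∑' k : ℕ, sinCoeff ν L k *
      ((1 - Real.cos ((k + 1) * Real.pi / L * x)) / (k + 1)) := by
  have hcos : ∀ y : ℝ, Summable fun k : ℕ => sinCoeff ν L k / (k + 1) *
      Real.cos ((k + 1) * Real.pi / L * y) := fun y => by
    refine Summable.of_norm_bounded hs fun k => ?_
    rw [norm_mul, norm_div, Real.norm_eq_abs, Real.norm_eq_abs,
        abs_of_nonneg (show (0 : ℝ) ≤ k + 1 by positivity)]
    exact mul_le_of_le_one_right (by positivity) (Real.abs_cos_le_one _)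
  have h1 := measureReal_Ioi_eq_tsum hL hν hs hx
  have h2 := measureReal_Ioi_eq_tsum hL hν hs (x := 0) ⟨le_rfl, hL⟩
  have h3 : ν.real (Ioi 0) = 1 := by
    have hpos : Ioi (0 : ℝ) =ᵐ[ν] univ := by
      rw [eventuallyEq_univ]
      filter_upwards [hν, measure_eq_zero_iff_ae_notMem.1 h0] with q hq hq0
      exact lt_of_le_of_ne hq.1 (Ne.symm hq0)
    rw [measureReal_congr hpos, probReal_univ]
  have h4 : ν.real (Iic x) = 1 - ν.real (Ioi x) := by
    rw [← compl_Iic, probReal_compl_eq_one_sub measurableSet_Iic]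
    ring
  have h5 : ν.real (Iic x) = 2 / Real.pi * (∑' k : ℕ, sinCoeff ν L k / (k + 1) *
      Real.cos ((k + 1) * Real.pi / L * 0) - ∑' k : ℕ, sinCoeff ν L k / (k + 1) *
      Real.cos ((k + 1) * Real.pi / L * x)) := by
    linarith
  rw [h5, ← (hcos 0).tsum_sub (hcos x)]
  congr 2 with k
  rw [mul_zero, Real.cos_zero]
  ring

end UniformSampleVariance

namespace UniformSampleVariance

open Complex Set Filter Topology

/-! ### The coefficients of the series -/

theorem neg_I_mul_ne_zero {t : ℝ} (ht : 0 < t) : -(I * (t : ℂ)) ≠ 0 := by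
  simp [ht.ne']

theorem sqrtNegI_sq (t : ℝ) : sqrtNegI t ^ 2 = -(I * t) := by
  have := cpow_nat_inv_pow (-(I * (t : ℂ))) two_ne_zero
  rw [sqrtNegI, one_div]
  exact_mod_cast this

theorem sqrtNegI_re_nonneg {t : ℝ} (ht : 0 < t) : 0 ≤ (sqrtNegI t).re := by
  rw [sqrtNegI, cpow_def_of_ne_zero (neg_I_mul_ne_zero ht), Complex.exp_re]
  refine mul_nonneg (Real.exp_pos _).le (Real.cos_nonneg_of_mem_Icc ?_)
  have h : (log (-(I * (t : ℂ))) * (1 / 2)).im = arg (-(I * (t : ℂ))) / 2 := by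
    rw [← log_im, show (1 / 2 : ℂ) = ((1 / 2 : ℝ) : ℂ) by norm_num, im_mul_ofReal]
    ring
  rw [h]
  constructor <;> linarith [neg_pi_lt_arg (-(I * (t : ℂ))), arg_le_pi (-(I * (t : ℂ)))]

theorem norm_sqrtNegI {t : ℝ} (ht : 0 < t) : ‖sqrtNegI t‖ = Real.sqrt t := by
  symm
  rw [Real.sqrt_eq_iff_mul_self_eq ht.le (norm_nonneg _), ← norm_mul, ← pow_two, sqrtNegI_sq]
  simp [abs_of_pos ht]

theorem sqrtNegI_ne_zero {t : ℝ} (ht : 0 < t) : sqrtNegI t ≠ 0 := by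
  rw [← norm_pos_iff, norm_sqrtNegI ht]
  positivity

/-- `(i / t) ^ (m / 2)` is the reciprocal of the `m`-th power of the principal root of `-i t`, since
`-i t` is off the branch cut. -/
theorem I_div_cpow {t : ℝ} (ht : 0 < t) (m : ℕ) :
    (I / (t : ℂ)) ^ ((m : ℂ) / 2) = (sqrtNegI t ^ m)⁻¹ := by
  have h1 : I / (t : ℂ) = (-(I * (t : ℂ)))⁻¹ := by
    have : (t : ℂ) ≠ 0 := by exact_mod_cast ht.ne'
    field_simp
    simp
  have harg : arg (-(I * (t : ℂ))) ≠ Real.pi := by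
    intro h
    rw [arg_eq_pi_iff] at h
    simp at h
  rw [h1, inv_cpow _ _ harg, sqrtNegI, ← cpow_nat_mul, mul_one_div]

/-- The power of `i / t_k` cancels the factors `√(-i t_k)` from the difference of error functions. -/
theorem coeffA_eq {n k : ℕ} (ht : 0 < freq n k) (y : ℝ) :
    coeffA n k y =
      (2 / Real.sqrt Real.pi) ^ n * (gaussSeg y (sqrtNegI (freq n k)) ^ n).im := by
  have h := sqrtNegI_ne_zero ht
  rw [coeffA, I_div_cpow ht, erf_sub_erf, ← im_ofReal_mul]
  congr 1
  push_cast
  rw [mul_pow, mul_pow (sqrtNegI _), mul_left_comm, inv_mul_cancel_left₀ (pow_ne_zero _ h)]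

/-- As for `coeffA`, except that one factor `√(-i t_k)` remains. -/
theorem coeffB_eq {n k : ℕ} (hn : 1 ≤ n) (ht : 0 < freq n k) (u : ℝ) :
    coeffB n k u = (2 / Real.sqrt Real.pi) ^ n * (sqrtNegI (freq n k) *
      gaussSeg (-(sqrtNegI (freq n k) * ((1 / 2 - u / 2 : ℝ) : ℂ))) (sqrtNegI (freq n k)) ^ n).im := by
  have h := sqrtNegI_ne_zero ht
  obtain ⟨m, rfl⟩ := Nat.exists_eq_add_of_le' hn
  set a := sqrtNegI (freq (m + 1) k)
  have e1 : ((((m + 1 : ℕ) : ℂ)) - 1) / 2 = (m : ℂ) / 2 := by push_cast; ring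
  have e2 : 1 / 2 * a * ((u : ℂ) + 1) = -(a * ((1 / 2 - u / 2 : ℝ) : ℂ)) + a := by
    push_cast
    ring
  have e3 : 1 / 2 * a * ((u : ℂ) - 1) = -(a * ((1 / 2 - u / 2 : ℝ) : ℂ)) := by
    push_cast
    ring
  rw [coeffB, e1, I_div_cpow ht, e2, e3, erf_sub_erf, ← im_ofReal_mul]
  congr 1
  change (a ^ m)⁻¹ * _ = _
  push_cast
  rw [mul_pow, mul_pow a, mul_left_comm, pow_succ a, mul_assoc (a ^ m),
    inv_mul_cancel_left₀ (pow_ne_zero _ h)]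

theorem norm_erf_le_two {z : ℂ} (hz : 0 ≤ z.re) (hz2 : (z ^ 2).re = 0) : ‖erf z‖ ≤ 2 := by
  have h := norm_one_sub_erf_le hz
  rw [hz2, neg_zero, Real.exp_zero] at h
  calc ‖erf z‖ = ‖1 - (1 - erf z)‖ := by rw [sub_sub_cancel]
    _ ≤ ‖(1 : ℂ)‖ + ‖1 - erf z‖ := norm_sub_le _ _
    _ ≤ 2 := by rw [norm_one]; linarith

/-- The square of `y + √(-i t)` has real part at least `y²`, so both complementary error functions
are at most `exp (-y²)`, uniformly in `t`. -/
theorem norm_erf_add_sub_erf_le {t y : ℝ} (ht : 0 < t) (hy : 0 ≤ y) :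
    ‖erf (y + sqrtNegI t) - erf y‖ ≤ 2 * Real.exp (-y ^ 2) := by
  have h1 := norm_one_sub_erf_le (z := (y : ℂ)) (by simpa using hy)
  have hre := sqrtNegI_re_nonneg ht
  have h2 := norm_one_sub_erf_le (z := y + sqrtNegI t) (by simp; linarith)
  have e1 : ((y : ℂ) ^ 2).re = y ^ 2 := by norm_cast
  have e2 : (((y : ℂ) + sqrtNegI t) ^ 2).re = y ^ 2 + 2 * y * (sqrtNegI t).re := by
    rw [add_sq, sqrtNegI_sq]
    simp [pow_two]
  rw [e1] at h1
  rw [e2] at h2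
  have h3 : Real.exp (-(y ^ 2 + 2 * y * (sqrtNegI t).re)) ≤ Real.exp (-y ^ 2) := by
    rw [Real.exp_le_exp]
    have := mul_nonneg hy hre
    linarith
  calc ‖erf (y + sqrtNegI t) - erf y‖ = ‖(1 - erf y) - (1 - erf (y + sqrtNegI t))‖ := by ring_nf
    _ ≤ _ := norm_sub_le _ _
    _ ≤ _ := by linarith

theorem norm_erf_sub_erf_le_four {t u : ℝ} (ht : 0 < t) (hu : u ∈ Icc (0 : ℝ) 1) :
    ‖erf (1 / 2 * sqrtNegI t * ((u : ℂ) + 1)) - erf (1 / 2 * sqrtNegI t * ((u : ℂ) - 1))‖ ≤ 4 := by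
  have h : ∀ r : ℝ, 0 ≤ r → ‖erf (sqrtNegI t * r)‖ ≤ 2 := fun r hr => by
    refine norm_erf_le_two ?_ ?_
    · rw [re_mul_ofReal]
      exact mul_nonneg (sqrtNegI_re_nonneg ht) hr
    · rw [mul_pow, sqrtNegI_sq, ← ofReal_pow, re_mul_ofReal]
      simp
  have e1 : 1 / 2 * sqrtNegI t * ((u : ℂ) + 1) = sqrtNegI t * ((u + 1) / 2 : ℝ) := by
    push_cast
    ring
  have e2 : 1 / 2 * sqrtNegI t * ((u : ℂ) - 1) = -(sqrtNegI t * ((1 - u) / 2 : ℝ)) := by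
    push_cast
    ring
  rw [e1, e2, erf_neg]
  refine (norm_sub_le _ _).trans ?_
  rw [norm_neg]
  linarith [h ((u + 1) / 2) (by linarith [hu.1]), h ((1 - u) / 2) (by linarith [hu.2])]

/-- The decay rate `(k + 1) ^ (-(n - 1) / 2)` of the coefficients. -/
noncomputable def weight (n k : ℕ) : ℝ := (Real.sqrt ((k : ℝ) + 1) ^ (n - 1))⁻¹

theorem weight_nonneg (n k : ℕ) : 0 ≤ weight n k := by
  unfold weight
  positivity

theorem summable_weight_div {n : ℕ} (hn : 3 ≤ n) :
    Summable fun k : ℕ => weight n k * (1 / ((k : ℝ) + 1)) := by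
  refine summable_one_div_succ_sq.of_nonneg_of_le
    (fun k => mul_nonneg (weight_nonneg n k) (by positivity)) fun k => ?_
  have h1 : (1 : ℝ) ≤ Real.sqrt ((k : ℝ) + 1) := Real.one_le_sqrt.2 (by linarith [k.cast_nonneg (α := ℝ)])
  have h2 : (k : ℝ) + 1 ≤ Real.sqrt ((k : ℝ) + 1) ^ (n - 1) := by
    calc (k : ℝ) + 1 = Real.sqrt ((k : ℝ) + 1) ^ 2 := (Real.sq_sqrt (by positivity)).symm
      _ ≤ _ := pow_le_pow_right₀ h1 (by lia)
  rw [weight, pow_two, ← one_div_mul_one_div, ← one_div]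
  gcongr

theorem summable_weight {n : ℕ} (hn : 4 ≤ n) : Summable fun k : ℕ => weight n k := by
  have h := (summable_nat_add_iff 1).2
    (Real.summable_one_div_nat_rpow.2 (by norm_num : (1 : ℝ) < 3 / 2))
  refine h.of_nonneg_of_le (fun k => weight_nonneg n k) fun k => ?_
  have h1 : (1 : ℝ) ≤ Real.sqrt ((k : ℝ) + 1) := Real.one_le_sqrt.2 (by linarith [k.cast_nonneg (α := ℝ)])
  have h2 : ((k : ℝ) + 1) ^ (3 / 2 : ℝ) ≤ Real.sqrt ((k : ℝ) + 1) ^ (n - 1) := by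
    calc ((k : ℝ) + 1) ^ (3 / 2 : ℝ) = Real.sqrt ((k : ℝ) + 1) ^ 3 := by
          rw [Real.sqrt_eq_rpow, ← Real.rpow_natCast, ← Real.rpow_mul (by positivity)]
          norm_num
      _ ≤ _ := pow_le_pow_right₀ h1 (by lia)
  rw [weight, ← one_div]
  push_cast
  gcongr

theorem exists_coeff_bound {n : ℕ} (hn : 2 ≤ n) : ∃ C : ℝ,
    (∀ (k : ℕ) (y : ℝ), 0 ≤ y →
      |coeffA n (k + 1) y| ≤ C * Real.exp (-y ^ 2) * weight n k) ∧
    (∀ (k : ℕ), ∀ u ∈ Icc (0 : ℝ) 1, |coeffB n (k + 1) u| ≤ C * weight n k) := by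
  obtain ⟨m, rfl⟩ := Nat.exists_eq_add_of_le' (show 1 ≤ n by lia)
  set c := Real.sqrt (Real.pi / Qmax (m + 1)) with hc
  have hcpos : 0 < c := by
    have := Qmax_pos hn
    positivity
  have hsqrt : ∀ k : ℕ, Real.sqrt (freq (m + 1) (k + 1)) = Real.sqrt ((k : ℝ) + 1) * c := by
    intro k
    rw [freq_succ hn, mul_div_assoc, Real.sqrt_mul (by positivity)]
  have hw : ∀ k : ℕ, (Real.sqrt (freq (m + 1) (k + 1)) ^ m)⁻¹ = (c ^ m)⁻¹ * weight (m + 1) k := by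
    intro k
    rw [hsqrt, weight, mul_pow, mul_inv, mul_comm, Nat.add_sub_cancel]
  refine ⟨(c ^ m)⁻¹ * 2 ^ (m + 1) * c⁻¹ + (c ^ m)⁻¹ * 4 ^ (m + 1), fun k y hy => ?_, fun k u hu => ?_⟩
  · have ht := freq_succ_pos hn k
    refine (abs_im_le_norm _).trans ?_
    rw [norm_mul, I_div_cpow ht, norm_inv, norm_pow, norm_sqrtNegI ht, norm_pow, pow_succ, mul_inv,
      hw]
    have h1 : (Real.sqrt (freq (m + 1) (k + 1)))⁻¹ ≤ c⁻¹ := by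
      rw [hsqrt]
      gcongr
      exact le_mul_of_one_le_left hcpos.le
        (Real.one_le_sqrt.2 (by linarith [k.cast_nonneg (α := ℝ)]))
    have h2 : ‖erf (y + sqrtNegI (freq (m + 1) (k + 1))) - erf y‖ ^ (m + 1) ≤
        2 ^ (m + 1) * Real.exp (-y ^ 2) := by
      calc _ ≤ (2 * Real.exp (-y ^ 2)) ^ (m + 1) := by
            gcongr
            exact norm_erf_add_sub_erf_le ht hy
        _ ≤ _ := by
            rw [mul_pow]
            gcongr
            exact pow_le_of_le_one (Real.exp_pos _).le
              (Real.exp_le_one_iff.2 (by linarith [sq_nonneg y])) (by lia)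
    have h3 := weight_nonneg (m + 1) k
    calc _ ≤ (c ^ m)⁻¹ * weight (m + 1) k * c⁻¹ * (2 ^ (m + 1) * Real.exp (-y ^ 2)) := by gcongr
      _ = ((c ^ m)⁻¹ * 2 ^ (m + 1) * c⁻¹ + 0) * Real.exp (-y ^ 2) * weight (m + 1) k := by ring
      _ ≤ _ := by gcongr; positivity
  · have ht := freq_succ_pos hn k
    refine (abs_im_le_norm _).trans ?_
    rw [show (((m + 1 : ℕ) : ℂ) - 1) / 2 = (m : ℂ) / 2 by push_cast; ring, norm_mul,
      I_div_cpow ht, norm_inv, norm_pow, norm_sqrtNegI ht, norm_pow, hw]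
    have h2 := norm_erf_sub_erf_le_four ht hu
    have h3 := weight_nonneg (m + 1) k
    calc _ ≤ (c ^ m)⁻¹ * weight (m + 1) k * 4 ^ (m + 1) := by gcongr
      _ = (0 + (c ^ m)⁻¹ * 4 ^ (m + 1)) * weight (m + 1) k := by ring
      _ ≤ _ := by gcongr; positivity

theorem continuous_coeffA (n k : ℕ) : Continuous (coeffA n k) := by
  have := differentiable_erf.continuous
  unfold coeffA
  fun_prop

theorem continuous_coeffB (n k : ℕ) : Continuous (coeffB n k) := by
  have := differentiable_erf.continuous
  unfold coeffB
  fun_prop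

/-! ### The characteristic function at the frequencies -/

theorem integrableOn_gaussSeg_pow {n : ℕ} (hn : n ≠ 0) (a : ℂ) :
    IntegrableOn (fun y : ℝ => gaussSeg y a ^ n) (Ioi 0) := by
  have hc : Continuous fun y : ℝ => gaussSeg y a ^ n :=
    (continuous_gaussSeg.comp (by fun_prop : Continuous fun y : ℝ => ((y : ℂ), a))).pow n
  have hb := ((integrable_exp_neg_sq_add (2 * n * ‖a‖)).const_mul
    (Real.exp (n * ‖a‖ ^ 2))).integrableOn (s := Ioi 0)
  refine Integrable.mono' hb hc.aestronglyMeasurable ?_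
  filter_upwards [ae_restrict_mem measurableSet_Ioi] with y hy
  exact norm_gaussSeg_pow_le hn (norm_nonneg a) (le_of_lt hy) le_rfl

theorem gaussSeg_unit_symm (a : ℂ) (z : ℝ) :
    gaussSeg (-(a * ((1 - z : ℝ) : ℂ))) a = gaussSeg (-(a * z)) a := by
  unfold gaussSeg
  have := intervalIntegral.integral_comp_sub_left (a := 0) (b := 1)
    (fun s : ℝ => exp (-(-(a * z) + a * s) ^ 2)) 1
  simp only [sub_self, sub_zero] at this
  rw [← this]
  congr 1 with s
  push_cast
  ring_nf

theorem integral_comp_half_sub_half {G : ℝ → ℂ} (hG : Continuous G) (hs : ∀ z, G (1 - z) = G z) :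
    ∫ u in (0 : ℝ)..1, G (1 / 2 - u / 2) = ∫ z in (0 : ℝ)..1, G z := by
  have h1 : ∫ u in (0 : ℝ)..1, G (1 / 2 - u / 2) = 2 * ∫ z in (0 : ℝ)..(1 / 2), G z := by
    rw [intervalIntegral.integral_comp_sub_div G two_ne_zero]
    norm_num
  have h2 : ∫ z in (1 / 2 : ℝ)..1, G z = ∫ z in (0 : ℝ)..(1 / 2), G z := by
    have := intervalIntegral.integral_comp_sub_left (a := 0) (b := 1 / 2) G 1
    simp only [hs] at this
    rw [this]
    norm_num
  rw [h1, ← intervalIntegral.integral_add_adjacent_intervals (hG.intervalIntegrable 0 (1 / 2))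
    (hG.intervalIntegrable (1 / 2) 1), h2]
  ring

/-- The law of `Q` under the uniform distribution on the cube. -/
noncomputable def lawQ (n : ℕ) : Measure ℝ := (cubeMeasure n).map Q

instance (n : ℕ) : IsProbabilityMeasure (lawQ n) :=
  Measure.isProbabilityMeasure_map (continuous_Q n).measurable.aemeasurable

/-- The sine coefficients of the law of `Q` are the imaginary parts of its characteristic function
at the frequencies `t_k`, that is, of `E exp (-a² Q)` with `a² = -i t_k`. -/
theorem sinCoeff_lawQ {n : ℕ} (hn : 2 ≤ n) (k : ℕ) :
    sinCoeff (lawQ n) (Qmax n) k = Real.sqrt (n / Real.pi) * (Real.sqrt Real.pi / 2) ^ n *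
      (2 * (∫ y in Ioi (0 : ℝ), coeffA n (k + 1) y) + ∫ u in (0 : ℝ)..1, coeffB n (k + 1) u) := by
  have hn0 : n ≠ 0 := by lia
  have ht := freq_succ_pos hn k
  have hs := sqrtNegI_sq (freq n (k + 1))
  have hA := coeffA_eq ht
  have hB := coeffB_eq (show 1 ≤ n by lia) ht
  set a := sqrtNegI (freq n (k + 1))
  have hI := integral_exp_neg_sq_mul_Q hn0 a
  have hcQ := continuous_Q n
  have e1 : sinCoeff (lawQ n) (Qmax n) k = (∫ v, exp (-(a ^ 2 * Q v)) ∂cubeMeasure n).im := by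
    have hint : Integrable (fun v => exp (-(a ^ 2 * Q v))) (cubeMeasure n) := by
      refine Integrable.of_bound (C := 1) (Continuous.aestronglyMeasurable (by fun_prop))
        (Eventually.of_forall fun v => ?_)
      rw [hs, Complex.norm_exp]
      simp
    rw [sinCoeff, lawQ, integral_map hcQ.measurable.aemeasurable
      (Continuous.aestronglyMeasurable (by fun_prop))]
    have := integral_im hint
    simp only [RCLike.im_to_complex] at this
    rw [← this]
    congr 1 with v
    rw [hs, ← freq_succ hn, show -(-(I * (freq n (k + 1) : ℂ)) * (Q v : ℂ)) =
      ((freq n (k + 1) * Q v : ℝ) : ℂ) * I by push_cast; ring, exp_ofReal_mul_I_im]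
  have e2 : ∫ y in Ioi (0 : ℝ), coeffA n (k + 1) y =
      (2 / Real.sqrt Real.pi) ^ n * (∫ y in Ioi (0 : ℝ), gaussSeg y a ^ n).im := by
    have := integral_im (integrableOn_gaussSeg_pow hn0 a)
    simp only [RCLike.im_to_complex] at this
    rw [← this, ← integral_const_mul]
    simp only [hA]
  have e3 : ∫ u in (0 : ℝ)..1, coeffB n (k + 1) u =
      (2 / Real.sqrt Real.pi) ^ n * (a * ∫ z in (0 : ℝ)..1, gaussSeg (-(a * z)) a ^ n).im := by
    have hc : Continuous fun z : ℝ => gaussSeg (-(a * z)) a ^ n :=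
      (continuous_gaussSeg.comp (by fun_prop : Continuous fun z : ℝ => (-(a * (z : ℂ)), a))).pow n
    rw [← integral_comp_half_sub_half hc (fun z => by rw [gaussSeg_unit_symm]),
      ← intervalIntegral.integral_const_mul]
    simp only [hB, intervalIntegral.integral_const_mul]
    congr 1
    have hc' := (hc.comp (by fun_prop : Continuous fun u : ℝ => 1 / 2 - u / 2)).const_smul a
    have := integral_im (𝕜 := ℂ) ((hc'.intervalIntegrable (μ := volume) 0 1).1)
    simp only [RCLike.im_to_complex] at this
    rw [intervalIntegral.integral_of_le zero_le_one, intervalIntegral.integral_of_le zero_le_one,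
      ← integral_const_mul]
    exact this
  rw [e1, hI, e2, e3, im_ofReal_mul, add_im]
  have h2 : ∀ z : ℂ, (2 * z).im = 2 * z.im := fun z => by simp
  have h3 : (Real.sqrt Real.pi / 2) ^ n * (2 / Real.sqrt Real.pi) ^ n = 1 := by
    rw [← mul_pow, div_mul_div_comm, mul_comm, div_self (by positivity), one_pow]
  rw [h2]
  linear_combination (-(Real.sqrt (n / Real.pi)) * (2 * (∫ y in Ioi (0 : ℝ), gaussSeg y a ^ n).im +
    (a * ∫ z in (0 : ℝ)..1, gaussSeg (-(a * z)) a ^ n).im)) * h3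

end UniformSampleVariance

namespace UniformSampleVariance

open Set Filter Topology

/-! ### The series and their integrals -/

theorem abs_cosFactor_le (n k : ℕ) (x : ℝ) : |cosFactor n (k + 1) x| ≤ 2 * (1 / ((k : ℝ) + 1)) := by
  rw [cosFactor, abs_div, Nat.cast_add_one, abs_of_nonneg (show (0 : ℝ) ≤ k + 1 by positivity),
    mul_one_div]
  gcongr
  rw [abs_le]
  constructor <;> linarith [Real.cos_le_one (freq n (k + 1) * x),
    Real.neg_one_le_cos (freq n (k + 1) * x)]

theorem abs_sinFactor_le {n : ℕ} (hn : 2 ≤ n) (k : ℕ) (x : ℝ) :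
    |sinFactor n (k + 1) x| ≤ Real.pi / Qmax n := by
  have hQ := Qmax_pos hn
  have ht := freq_succ_pos hn k
  rw [sinFactor, abs_div, abs_mul, Nat.cast_add_one, abs_of_pos ht,
    abs_of_nonneg (show (0 : ℝ) ≤ k + 1 by positivity), div_le_iff₀ (by positivity)]
  calc _ ≤ freq n (k + 1) * 1 := by
        gcongr
        exact Real.abs_sin_le_one _
    _ = _ := by
        rw [freq_succ hn]
        ring

theorem hasDerivAt_cosFactor (n k : ℕ) (x : ℝ) :
    HasDerivAt (cosFactor n k) (sinFactor n k x) x := by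
  have h1 : HasDerivAt (fun y : ℝ => freq n k * y) (freq n k) x := by
    simpa using (hasDerivAt_id x).const_mul (freq n k)
  convert! (h1.cos.const_sub 1).div_const (k : ℝ) using 1
  rw [sinFactor]
  ring

theorem summable_mul_of_abs_le {c d w e : ℕ → ℝ} (hc : ∀ k, |c k| ≤ w k) (hd : ∀ k, |d k| ≤ e k)
    (hs : Summable fun k => w k * e k) : Summable fun k => c k * d k :=
  Summable.of_norm_bounded hs fun k => by
    rw [Real.norm_eq_abs, abs_mul]
    exact mul_le_mul (hc k) (hd k) (abs_nonneg _) ((abs_nonneg _).trans (hc k))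

theorem hasDerivAt_tsum_cosFactor {n : ℕ} (hn : 2 ≤ n) {c w : ℕ → ℝ} (hc : ∀ k, |c k| ≤ w k)
    (hw : Summable w) (x : ℝ) :
    HasDerivAt (fun x => ∑' k : ℕ, c k * cosFactor n (k + 1) x)
      (∑' k : ℕ, c k * sinFactor n (k + 1) x) x := by
  refine hasDerivAt_tsum (y₀ := 0) (hw.mul_right (Real.pi / Qmax n))
    (g := fun k x => c k * cosFactor n (k + 1) x) (g' := fun k x => c k * sinFactor n (k + 1) x)
    (fun k y => (hasDerivAt_cosFactor n (k + 1) y).const_mul _) (fun k y => ?_) ?_ x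
  · rw [Real.norm_eq_abs, abs_mul]
    exact mul_le_mul (hc k) (abs_sinFactor_le hn k y) (abs_nonneg _) ((abs_nonneg _).trans (hc k))
  · simp [cosFactor]

/-- Termwise integration of a series dominated by a fixed integrable function. -/
theorem integrable_tsum_and_hasSum_integral {α : Type*} [MeasurableSpace α] {μ : Measure α}
    {c : ℕ → α → ℝ} {g : α → ℝ} {w d e : ℕ → ℝ} (hc : ∀ k, AEStronglyMeasurable (c k) μ)
    (hg : Integrable g μ) (hcw : ∀ᵐ y ∂μ, ∀ k, |c k y| ≤ g y * w k) (hd : ∀ k, |d k| ≤ e k)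
    (hs : Summable fun k => w k * e k) :
    Integrable (fun y => ∑' k, c k y * d k) μ ∧
      HasSum (fun k => (∫ y, c k y ∂μ) * d k) (∫ y, ∑' k, c k y * d k ∂μ) := by
  have hbound : ∀ᵐ y ∂μ, ∀ k, ‖c k y * d k‖ ≤ g y * (w k * e k) := by
    filter_upwards [hcw] with y hy k
    rw [Real.norm_eq_abs, abs_mul, ← mul_assoc]
    exact mul_le_mul (hy k) (hd k) (abs_nonneg _) ((abs_nonneg _).trans (hy k))
  have hsum : ∀ᵐ y ∂μ, Summable fun k => c k y * d k := by
    filter_upwards [hbound] with y hy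
    exact Summable.of_norm_bounded (hs.mul_left (g y)) hy
  have hgw : Integrable (fun y => ∑' k, g y * (w k * e k)) μ := by
    simp_rw [tsum_mul_left]
    exact hg.mul_const _
  constructor
  · refine hgw.mono' ?_ ?_
    · refine aestronglyMeasurable_of_tendsto_ae atTop
        (f := fun N y => ∑ k ∈ Finset.range N, c k y * d k) (fun N => ?_) ?_
      · exact Finset.aestronglyMeasurable_fun_sum _ fun k _ => (hc k).mul_const _
      · filter_upwards [hsum] with y hy
        exact hy.hasSum.tendsto_sum_nat
    · filter_upwards [hbound] with y hy
      exact tsum_of_norm_bounded (hs.mul_left (g y)).hasSum hy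
  · simp_rw [← integral_mul_const]
    refine hasSum_integral_of_dominated_convergence (fun k y => g y * (w k * e k))
      (fun k => (hc k).mul_const _) (fun k => hbound.mono fun y hy => hy k)
      (Eventually.of_forall fun y => hs.mul_left (g y)) hgw (hsum.mono fun y hy => hy.hasSum)

theorem integrable_and_hasSum_coeff {n : ℕ} (hn : 2 ≤ n) {d e : ℕ → ℝ} (hd : ∀ k, |d k| ≤ e k)
    (hs : Summable fun k => weight n k * e k) :
    IntegrableOn (fun y => ∑' k, coeffA n (k + 1) y * d k) (Ioi 0) ∧
    IntervalIntegrable (fun u => ∑' k, coeffB n (k + 1) u * d k) volume 0 1 ∧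
    ∑' k, sinCoeff (lawQ n) (Qmax n) k * d k = 2 * (Real.sqrt (n / Real.pi) *
      (Real.sqrt Real.pi / 2) ^ n) * ((∫ y in Ioi (0 : ℝ), ∑' k, coeffA n (k + 1) y * d k) +
        1 / 2 * ∫ u in (0 : ℝ)..1, ∑' k, coeffB n (k + 1) u * d k) := by
  obtain ⟨C, hA, hB⟩ := exists_coeff_bound hn
  have h1 := integrable_tsum_and_hasSum_integral (μ := volume.restrict (Ioi (0 : ℝ)))
    (c := fun k => coeffA n (k + 1)) (g := fun y => C * Real.exp (-y ^ 2)) (w := weight n)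
    (fun k => (continuous_coeffA n (k + 1)).aestronglyMeasurable)
    (integrable_exp_neg_sq.const_mul C).integrableOn
    ((ae_restrict_mem measurableSet_Ioi).mono fun y hy k => hA k y (le_of_lt hy)) hd hs
  have h2 := integrable_tsum_and_hasSum_integral (μ := volume.restrict (Ioc (0 : ℝ) 1))
    (c := fun k => coeffB n (k + 1)) (g := fun _ => C) (w := weight n)
    (fun k => (continuous_coeffB n (k + 1)).aestronglyMeasurable)
    (integrable_const C)
    ((ae_restrict_mem measurableSet_Ioc).mono fun u hu k => hB k u (Ioc_subset_Icc_self hu)) hd hs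
  refine ⟨h1.1, (intervalIntegrable_iff_integrableOn_Ioc_of_le zero_le_one).2 h2.1, ?_⟩
  have h3 := ((h1.2.mul_left 2).add h2.2).mul_left
    (Real.sqrt (n / Real.pi) * (Real.sqrt Real.pi / 2) ^ n)
  rw [intervalIntegral.integral_of_le zero_le_one]
  convert! h3.tsum_eq using 1
  · congr 1 with k
    rw [sinCoeff_lawQ hn, intervalIntegral.integral_of_le zero_le_one]
    ring
  · ring

theorem exists_abs_sinCoeff_le {n : ℕ} (hn : 2 ≤ n) :
    ∃ C, ∀ k, |sinCoeff (lawQ n) (Qmax n) k| ≤ C * weight n k := by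
  obtain ⟨C, hA, hB⟩ := exists_coeff_bound hn
  refine ⟨Real.sqrt (n / Real.pi) * (Real.sqrt Real.pi / 2) ^ n *
    (2 * (∫ y in Ioi (0 : ℝ), C * Real.exp (-y ^ 2)) + C), fun k => ?_⟩
  have h1 : |∫ y in Ioi (0 : ℝ), coeffA n (k + 1) y| ≤
      (∫ y in Ioi (0 : ℝ), C * Real.exp (-y ^ 2)) * weight n k := by
    rw [← integral_mul_const]
    exact norm_integral_le_of_norm_le (f := coeffA n (k + 1))
      ((integrable_exp_neg_sq.const_mul C).mul_const _).integrableOn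
      ((ae_restrict_mem measurableSet_Ioi).mono fun y hy => hA k y (le_of_lt hy))
  have h2 : |∫ u in (0 : ℝ)..1, coeffB n (k + 1) u| ≤ C * weight n k := by
    have := intervalIntegral.norm_integral_le_of_norm_le_const (a := 0) (b := 1)
      (f := coeffB n (k + 1)) (C := C * weight n k) (fun u hu => hB k u ?_)
    · simpa using this
    · rw [uIoc_of_le zero_le_one] at hu
      exact Ioc_subset_Icc_self hu
  rw [sinCoeff_lawQ hn, abs_mul, abs_of_nonneg (show 0 ≤ Real.sqrt (n / Real.pi) *
    (Real.sqrt Real.pi / 2) ^ n by positivity), mul_assoc _ _ (weight n k)]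
  gcongr
  refine (abs_add_le _ _).trans ?_
  rw [abs_mul, abs_two]
  linarith

theorem normalizing_constant (n : ℕ) :
    2 / Real.pi * (2 * (Real.sqrt (n / Real.pi) * (Real.sqrt Real.pi / 2) ^ n)) =
      1 / 2 * Real.sqrt n * (Real.sqrt Real.pi / 2) ^ ((n : ℤ) - 3) := by
  have hs : 0 < Real.sqrt Real.pi := by positivity
  have hsq : Real.sqrt Real.pi ^ 2 = Real.pi := Real.sq_sqrt Real.pi_pos.le
  rw [zpow_sub₀ (by positivity), zpow_natCast, Real.sqrt_div (by positivity)]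
  have h3 : ((Real.sqrt Real.pi / 2) ^ (3 : ℤ)) = Real.pi * Real.sqrt Real.pi / 8 := by
    rw [show (3 : ℤ) = ((3 : ℕ) : ℤ) by rfl, zpow_natCast]
    linear_combination (Real.sqrt Real.pi / 8) * hsq
  rw [h3]
  field_simp
  ring

theorem summable_weight_cos {n : ℕ} (hn : 3 ≤ n) :
    Summable fun k : ℕ => weight n k * (2 * (1 / ((k : ℝ) + 1))) := by
  simpa only [mul_left_comm] using (summable_weight_div hn).mul_left 2

theorem cdfFormula_eq_tsum {n : ℕ} (hn : 3 ≤ n) (x : ℝ) :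
    cdfFormula n x =
      2 / Real.pi * ∑' k, sinCoeff (lawQ n) (Qmax n) k * cosFactor n (k + 1) x := by
  rw [(integrable_and_hasSum_coeff (by lia) (fun k => abs_cosFactor_le n k x)
    (summable_weight_cos hn)).2.2, ← mul_assoc, normalizing_constant]
  rfl

theorem densityFormula_eq_tsum {n : ℕ} (hn : 4 ≤ n) (x : ℝ) :
    densityFormula n x =
      2 / Real.pi * ∑' k, sinCoeff (lawQ n) (Qmax n) k * sinFactor n (k + 1) x := by
  rw [(integrable_and_hasSum_coeff (by lia) (fun k => abs_sinFactor_le (by lia) k x)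
    ((summable_weight hn).mul_right _)).2.2, ← mul_assoc, normalizing_constant]
  rfl

theorem hasDerivAt_cdfFormula {n : ℕ} (hn : 4 ≤ n) (x : ℝ) :
    HasDerivAt (cdfFormula n) (densityFormula n x) x := by
  obtain ⟨C, hC⟩ := exists_abs_sinCoeff_le (n := n) (by lia)
  rw [densityFormula_eq_tsum hn, show cdfFormula n = _ from funext (cdfFormula_eq_tsum (by lia))]
  exact (hasDerivAt_tsum_cosFactor (by lia) hC ((summable_weight hn).mul_left C) x).const_mul _

theorem continuous_densityFormula {n : ℕ} (hn : 4 ≤ n) : Continuous (densityFormula n) := by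
  obtain ⟨C, hC⟩ := exists_abs_sinCoeff_le (n := n) (by lia)
  rw [show densityFormula n = _ from funext (densityFormula_eq_tsum hn)]
  refine continuous_const.mul (continuous_tsum (fun k => ?_)
    (((summable_weight hn).mul_left C).mul_right (Real.pi / Qmax n)) fun k x => ?_)
  · unfold sinFactor
    fun_prop
  · rw [Real.norm_eq_abs, abs_mul]
    exact mul_le_mul (hC k) (abs_sinFactor_le (by lia) k x) (abs_nonneg _)
      ((abs_nonneg _).trans (hC k))

/-! ### The distribution of the sample variance -/

theorem ae_lawQ_iff {n : ℕ} {p : ℝ → Prop} (hp : MeasurableSet {x | p x}) :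
    (∀ᵐ q ∂lawQ n, p q) ↔ ∀ᵐ v ∂cubeMeasure n, p (Q v) :=
  ae_map_iff (continuous_Q n).measurable.aemeasurable hp

theorem ae_lawQ_mem_Ico {n : ℕ} (hn : 2 ≤ n) : ∀ᵐ q ∂lawQ n, q ∈ Ico 0 (Qmax n) :=
  (ae_lawQ_iff measurableSet_Ico).2 ((ae_Q_lt_Qmax hn).mono fun v hv => ⟨Q_nonneg v, hv⟩)

theorem lawQ_singleton_zero {n : ℕ} (hn : 2 ≤ n) : lawQ n {0} = 0 := by
  rw [measure_eq_zero_iff_ae_notMem]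
  exact (ae_lawQ_iff (measurableSet_singleton (0 : ℝ)).compl).2 (ae_Q_ne_zero hn)

theorem lawQ_real_Iic {n : ℕ} (hn : 3 ≤ n) {x : ℝ} (hx : x ∈ Ico 0 (Qmax n)) :
    (lawQ n).real (Iic x) = cdfFormula n x := by
  obtain ⟨C, hC⟩ := exists_abs_sinCoeff_le (n := n) (by lia)
  rw [cdfFormula_eq_tsum hn, measureReal_Iic_eq_tsum (Qmax_pos (by lia))
    ((ae_lawQ_mem_Ico (by lia)).mono fun q hq => Ico_subset_Icc_self hq)
    (lawQ_singleton_zero (by lia)) ?_ hx]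
  · congr 2 with k
    rw [cosFactor, freq_succ (by lia), Nat.cast_add_one]
  · refine ((summable_weight_div hn).mul_left C).of_nonneg_of_le (fun k => by positivity)
      fun k => ?_
    rw [div_eq_mul_one_div, ← mul_assoc]
    gcongr
    exact hC k

theorem lawQ_Iic_of_neg {n : ℕ} (hn : 2 ≤ n) {x : ℝ} (hx : x < 0) : lawQ n (Iic x) = 0 := by
  rw [measure_eq_zero_iff_ae_notMem]
  filter_upwards [ae_lawQ_mem_Ico hn] with q hq h
  exact absurd (hq.1.trans h) (not_le.2 hx)

theorem hasDerivAt_lawQ_real_Iic {n : ℕ} (hn : 4 ≤ n) {x : ℝ} (hx : x ∈ Ico 0 (Qmax n)) :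
    HasDerivAt (fun y => (lawQ n).real (Iic y)) (densityFormula n x) x := by
  have hd := hasDerivAt_cdfFormula hn x
  have hR : HasDerivWithinAt (fun y => (lawQ n).real (Iic y)) (densityFormula n x) (Ici x) x := by
    refine hd.hasDerivWithinAt.congr_of_eventuallyEq ?_ (lawQ_real_Iic (by lia) hx)
    filter_upwards [Ico_mem_nhdsGE hx.2] with y hy
    exact lawQ_real_Iic (by lia) ⟨hx.1.trans hy.1, hy.2⟩
  have hL : HasDerivWithinAt (fun y => (lawQ n).real (Iic y)) (densityFormula n x) (Iic x) x := by
    rcases hx.1.eq_or_lt with rfl | h0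
    · -- all sine terms vanish at `0`, matching the constant value `0` to the left
      have hf : densityFormula n 0 = 0 := by
        rw [densityFormula_eq_tsum hn]
        simp [sinFactor]
      have hc : cdfFormula n 0 = 0 := by
        rw [cdfFormula_eq_tsum (by lia)]
        simp [cosFactor]
      have hz : ∀ y ∈ Iic (0 : ℝ), (lawQ n).real (Iic y) = 0 := by
        intro y hy
        rcases (mem_Iic.1 hy).eq_or_lt with rfl | hy
        · rw [lawQ_real_Iic (by lia) hx, hc]
        · rw [measureReal_def, lawQ_Iic_of_neg (by lia) hy, ENNReal.toReal_zero]
      rw [hf]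
      exact (hasDerivWithinAt_const (0 : ℝ) (Iic 0) (0 : ℝ)).congr hz (hz 0 self_mem_Iic)
    · refine hd.hasDerivWithinAt.congr_of_eventuallyEq ?_ (lawQ_real_Iic (by lia) hx)
      filter_upwards [Ioc_mem_nhdsLE h0] with y hy
      exact lawQ_real_Iic (by lia) ⟨hy.1.le, hy.2.trans_lt hx.2⟩
  simpa [Iic_union_Ici] using hL.union hR

theorem densityFormula_nonneg {n : ℕ} (hn : 4 ≤ n) {x : ℝ} (hx : x ∈ Ico 0 (Qmax n)) :
    0 ≤ densityFormula n x := by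
  have hm : Monotone fun y => (lawQ n).real (Iic y) :=
    fun y z hyz => measureReal_mono (Iic_subset_Iic.2 hyz)
  exact (hasDerivAt_lawQ_real_Iic hn hx).nonneg_of_monotone hm

theorem lawQ_Iic_eq_lintegral {n : ℕ} (hn : 4 ≤ n) {x : ℝ} (hx : x ∈ Ico 0 (Qmax n)) :
    lawQ n (Iic x) = ∫⁻ y in Icc 0 x, ENNReal.ofReal (densityFormula n y) := by
  have hc := continuous_densityFormula hn
  rw [← ofReal_integral_eq_lintegral_ofReal (hc.integrableOn_Icc)
    ((ae_restrict_mem measurableSet_Icc).mono fun y hy =>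
      densityFormula_nonneg hn ⟨hy.1, hy.2.trans_lt hx.2⟩),
    integral_Icc_eq_integral_Ioc, ← intervalIntegral.integral_of_le hx.1,
    intervalIntegral.integral_eq_sub_of_hasDerivAt (fun y _ => hasDerivAt_cdfFormula hn y)
      (hc.intervalIntegrable _ _), ← lawQ_real_Iic (by lia) hx, cdfFormula_eq_tsum (by lia) 0]
  simp [cosFactor]

/-- The two measures agree on `(-∞, x]` for `x < Qmax`, hence on `(-∞, Qmax)`, and neither charges
`[Qmax, ∞)`. -/
theorem lawQ_eq_withDensity {n : ℕ} (hn : 4 ≤ n) :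
    lawQ n = volume.withDensity fun x =>
      ENNReal.ofReal ((Ico 0 (Qmax n)).indicator (densityFormula n) x) := by
  set ρ : Measure ℝ := volume.withDensity fun x =>
      ENNReal.ofReal ((Ico 0 (Qmax n)).indicator (densityFormula n) x) with hρ
  have hρ' : ∀ s : Set ℝ, MeasurableSet s →
      ρ s = ∫⁻ y in Ico 0 (Qmax n) ∩ s, ENNReal.ofReal (densityFormula n y) := by
    intro s hs
    rw [hρ, withDensity_apply _ hs, ← Measure.restrict_restrict measurableSet_Ico,
      ← lintegral_indicator measurableSet_Ico]
    congr 1 with y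
    by_cases hy : y ∈ Ico 0 (Qmax n) <;> simp [hy]
  have hlt : ∀ x < Qmax n, lawQ n (Iic x) = ρ (Iic x) := by
    intro x hx
    rw [hρ' _ measurableSet_Iic]
    rcases lt_or_ge x 0 with h0 | h0
    · rw [lawQ_Iic_of_neg (by lia) h0, show Ico 0 (Qmax n) ∩ Iic x = ∅ from ?_]
      · simp
      · ext y
        simp only [mem_inter_iff, mem_Ico, mem_Iic, mem_empty_iff_false, iff_false]
        intro h
        linarith [h.1.1, h.2]
    · rw [lawQ_Iic_eq_lintegral hn ⟨h0, hx⟩]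
      congr 2
      ext y
      simp only [mem_inter_iff, mem_Ico, mem_Iic, mem_Icc]
      constructor
      · exact fun h => ⟨⟨h.1, h.2.trans_lt hx⟩, h.2⟩
      · exact fun h => ⟨h.1.1, h.2⟩
  have hIio : lawQ n (Iio (Qmax n)) = ρ (Iio (Qmax n)) := by
    obtain ⟨u, hu, hul, hut⟩ := exists_seq_strictMono_tendsto (Qmax n)
    have hU : ⋃ k, Iic (u k) = Iio (Qmax n) := by
      ext y
      simp only [mem_iUnion, mem_Iic, mem_Iio]
      refine ⟨fun ⟨k, hk⟩ => hk.trans_lt (hul k), fun hy => ?_⟩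
      obtain ⟨k, hk⟩ := (hut.eventually (lt_mem_nhds hy)).exists
      exact ⟨k, hk.le⟩
    have hm : Monotone fun k => Iic (u k) := fun i j hij => Iic_subset_Iic.2 (hu.monotone hij)
    have h1 := tendsto_measure_iUnion_atTop (μ := lawQ n) hm
    have h2 := tendsto_measure_iUnion_atTop (μ := ρ) hm
    rw [hU] at h1 h2
    refine tendsto_nhds_unique h1 (h2.congr fun k => ?_)
    exact (hlt _ (hul k)).symm
  have hlaw0 : lawQ n (Ici (Qmax n)) = 0 := by
    rw [measure_eq_zero_iff_ae_notMem]
    filter_upwards [ae_lawQ_mem_Ico (n := n) (by lia)] with q hq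
    simpa using hq.2
  have hρ0 : ρ (Ici (Qmax n)) = 0 := by
    rw [hρ' _ measurableSet_Ici, show Ico 0 (Qmax n) ∩ Ici (Qmax n) = ∅ from ?_]
    · simp
    · ext y
      simp only [mem_inter_iff, mem_Ico, mem_Ici, mem_empty_iff_false, iff_false]
      intro h
      linarith [h.1.2, h.2]
  refine Measure.ext_of_Iic _ _ fun x => ?_
  rcases lt_or_ge x (Qmax n) with h | h
  · exact hlt x h
  · have hsplit : ∀ m : Measure ℝ, m (Ici (Qmax n)) = 0 → m (Iic x) = m (Iio (Qmax n)) := by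
      intro m hm
      refine le_antisymm ?_ (measure_mono fun y hy => (le_of_lt hy).trans h)
      calc m (Iic x) ≤ m (Iio (Qmax n) ∪ Ici (Qmax n)) :=
            measure_mono (by rw [Iio_union_Ici]; exact subset_univ _)
        _ ≤ _ := (measure_union_le _ _).trans (by rw [hm, add_zero])
    rw [hsplit _ hlaw0, hsplit _ hρ0, hIio]

theorem map_Q_eq_lawQ {Ω : Type*} [MeasurableSpace Ω] {P : Measure Ω} [IsProbabilityMeasure P]
    {n : ℕ} {X : Fin n → Ω → ℝ} (hindep : iIndepFun X P)
    (hunif : ∀ i, pdf.IsUniform (X i) (Icc (0 : ℝ) 1) P volume) :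
    AEMeasurable (fun ω => Q fun i => X i ω) P ∧ P.map (fun ω => Q fun i => X i ω) = lawQ n := by
  have hX : ∀ i, AEMeasurable (X i) P := fun i => (hunif i).aemeasurable (by simp) (by simp)
  have hmap : ∀ i, P.map (X i) = volume.restrict (Icc (0 : ℝ) 1) := by
    intro i
    rw [hunif i, ProbabilityTheory.cond]
    simp
  have hXv : AEMeasurable (fun ω i => X i ω) P := aemeasurable_pi_iff.2 hX
  have hjoint : P.map (fun ω i => X i ω) = cubeMeasure n := by
    rw [(iIndepFun_iff_map_fun_eq_pi_map hX).1 hindep, cubeMeasure]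
    simp only [hmap]
  have hQ := (continuous_Q n).measurable
  refine ⟨hQ.comp_aemeasurable hXv, ?_⟩
  rw [lawQ, ← hjoint, AEMeasurable.map_map_of_aemeasurable hQ.aemeasurable hXv]
  rfl

end UniformSampleVariance

theorem theorem3 {Ω : Type*} [MeasurableSpace Ω] (P : Measure Ω) [IsProbabilityMeasure P]
    (n : ℕ) (hn : 3 ≤ n) (X : Fin n → Ω → ℝ) (hindep : iIndepFun X P)
    (hunif : ∀ i, pdf.IsUniform (X i) (Set.Icc (0 : ℝ) 1) P volume) :
    -- the distribution function: everything converges, and the formula holds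
    (∀ x : ℝ, 0 ≤ x → x < UniformSampleVariance.Qmax n →
      (∀ y : ℝ, 0 ≤ y → Summable fun k : ℕ =>
        UniformSampleVariance.coeffA n (k + 1) y * UniformSampleVariance.cosFactor n (k + 1) x) ∧
      (∀ u ∈ Set.Icc (0 : ℝ) 1, Summable fun k : ℕ =>
        UniformSampleVariance.coeffB n (k + 1) u * UniformSampleVariance.cosFactor n (k + 1) x) ∧
      IntegrableOn (UniformSampleVariance.seriesA n x) (Set.Ioi 0) volume ∧
      IntervalIntegrable (UniformSampleVariance.seriesB n x) volume 0 1 ∧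
      P.real {ω | UniformSampleVariance.Q (fun i => X i ω) ≤ x} =
        UniformSampleVariance.cdfFormula n x) ∧
    -- the density, by differentiation under the integrals
    (4 ≤ n →
      (∀ x : ℝ, 0 ≤ x → x < UniformSampleVariance.Qmax n →
        (∀ y : ℝ, 0 ≤ y →
          (Summable fun k : ℕ => UniformSampleVariance.coeffA n (k + 1) y *
            UniformSampleVariance.sinFactor n (k + 1) x) ∧
          HasDerivAt (fun x' => UniformSampleVariance.seriesA n x' y)
            (UniformSampleVariance.dseriesA n x y) x) ∧
        (∀ u ∈ Set.Icc (0 : ℝ) 1,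
          (Summable fun k : ℕ => UniformSampleVariance.coeffB n (k + 1) u *
            UniformSampleVariance.sinFactor n (k + 1) x) ∧
          HasDerivAt (fun x' => UniformSampleVariance.seriesB n x' u)
            (UniformSampleVariance.dseriesB n x u) x) ∧
        IntegrableOn (UniformSampleVariance.dseriesA n x) (Set.Ioi 0) volume ∧
        IntervalIntegrable (UniformSampleVariance.dseriesB n x) volume 0 1 ∧
        HasDerivAt (fun x' => P.real {ω | UniformSampleVariance.Q (fun i => X i ω) ≤ x'})
          (UniformSampleVariance.densityFormula n x) x) ∧
      P.map (fun ω => UniformSampleVariance.Q (fun i => X i ω)) =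
        volume.withDensity (fun x => ENNReal.ofReal
          ((Set.Ico 0 (UniformSampleVariance.Qmax n)).indicator
            (UniformSampleVariance.densityFormula n) x))) := by
  have hn2 : 2 ≤ n := by lia
  obtain ⟨hQm, hlaw⟩ := UniformSampleVariance.map_Q_eq_lawQ hindep hunif
  have hcdf : ∀ x : ℝ, P.real {ω | UniformSampleVariance.Q (fun i => X i ω) ≤ x} =
      (UniformSampleVariance.lawQ n).real (Set.Iic x) := by
    intro x
    rw [← hlaw, map_measureReal_apply_of_aemeasurable hQm measurableSet_Iic]
    rfl
  obtain ⟨C, hA, hB⟩ := UniformSampleVariance.exists_coeff_bound hn2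
  refine ⟨fun x hx0 hx => ?_, fun hn4 => ⟨fun x hx0 hx => ?_, ?_⟩⟩
  · have hcos := fun k => UniformSampleVariance.abs_cosFactor_le n k x
    have hs := UniformSampleVariance.summable_weight_cos hn
    obtain ⟨h1, h2, -⟩ := UniformSampleVariance.integrable_and_hasSum_coeff hn2 hcos hs
    refine ⟨fun y hy => ?_, fun u hu => ?_, h1, h2, ?_⟩
    · refine UniformSampleVariance.summable_mul_of_abs_le (fun k => hA k y hy) hcos ?_
      simpa only [mul_assoc] using hs.mul_left (C * Real.exp (-y ^ 2))
    · refine UniformSampleVariance.summable_mul_of_abs_le (fun k => hB k u hu) hcos ?_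
      simpa only [mul_assoc] using hs.mul_left C
    · rw [hcdf, UniformSampleVariance.lawQ_real_Iic hn ⟨hx0, hx⟩]
  · have hsin := fun k => UniformSampleVariance.abs_sinFactor_le hn2 k x
    have hw := UniformSampleVariance.summable_weight hn4
    obtain ⟨h1, h2, -⟩ := UniformSampleVariance.integrable_and_hasSum_coeff hn2 hsin
      (hw.mul_right _)
    refine ⟨fun y hy => ⟨?_, ?_⟩, fun u hu => ⟨?_, ?_⟩, h1, h2, ?_⟩
    · exact UniformSampleVariance.summable_mul_of_abs_le (fun k => hA k y hy) hsin
        ((hw.mul_left _).mul_right _)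
    · exact UniformSampleVariance.hasDerivAt_tsum_cosFactor hn2 (fun k => hA k y hy)
        (hw.mul_left _) x
    · exact UniformSampleVariance.summable_mul_of_abs_le (fun k => hB k u hu) hsin
        ((hw.mul_left _).mul_right _)
    · exact UniformSampleVariance.hasDerivAt_tsum_cosFactor hn2 (fun k => hB k u hu)
        (hw.mul_left _) x
    · simp only [hcdf]
      exact UniformSampleVariance.hasDerivAt_lawQ_real_Iic hn4 ⟨hx0, hx⟩
  · rw [hlaw]
    exact UniformSampleVariance.lawQ_eq_withDensity hn4
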